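/- Let $n\ge 2$, let $(\widetilde M(c),\widetilde g)$ be an $m$-dimensional real space form, i.e. a smooth Riemannian manifold all of whose sectional curvatures equal the constant $c$, and let $(M,g)$ be an $n$-dimensional Riemannian submanifold of $\widetilde M(c)$ (a smooth isometric immersion), with second fundamental form $\sigma$, shape operators $A_N$ given by $g(A_NX,Y)=\widetilde g(\sigma(X,Y),N)$, and normal connection $\nabla^\perp$ with curvature $R^\perp$. For $p\in M$ and an orthonormal basis $e_1,\dots,e_n$ of $T_pM$ let $\tau(p)=\sum_{i<j}K(e_i\wedge e_j)$ be the scalar curvature, where $K$ denotes the sectional curvature of $M$, and $\tau_{\rm Nor}(p)=\frac{2\tau(p)}{n(n-1)}$ the normalized scalar curvature. The Casorati curvature is $\mathcal C_p=\frac1n\sum_{i,j=1}^n\|\sigma(e_i,e_j)\|^2$, and for a hyperplane $\Pi\subset T_pM$ with orthonormal basis $b_1,\dots,b_{n-1}$ put $\mathcal C(\Pi)=\frac1{n-1}\sum_{i,j=1}^{n-1}\|\sigma(b_i,b_j)\|^2$. For $r>0$, $r\ne n(n-1)$, let $a(r)=\frac{1}{nr}(n-1)(n+r)(n^2-n-r)$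 and $$[\delta_{\mathcal C}(r;n-1)]_p=r\,\mathcal C_p+a(r)\inf_{\Pi}\mathcal C(\Pi)\quad(0<r<n(n-1)),\qquad [\widehat\delta_{\mathcal C}(r;n-1)]_p=r\,\mathcal C_p+a(r)\sup_{\Pi}\mathcal C(\Pi)\quad(r>n(n-1)),$$ where $\Pi$ runs over the hyperplanes of $T_pM$. Then, for every $p\in M$, $$\tau_{\rm Nor}(p)\le\frac{1}{n(n-1)}[\delta_{\mathcal C}(r;n-1)]_p+c\quad\text{if }0<r<n(n-1),\tag{1}$$ $$\tau_{\rm Nor}(p)\le\frac{1}{n(n-1)}[\widehat\delta_{\mathcal C}(r;n-1)]_p+c\quad\text{if }r>n(n-1).\tag{2}$$ Moreover, for given $r$ in the respective range, equality holds in (1) (resp. in (2)) at all $p\in M$ if and only if the following three conditions hold: (i) $M$ is invariantly quasi-umbilical: at each $p$ there are $m-n$ mutually orthogonal unit normal vectors $N_{n+1},\dots,N_m$ and a unit vector $u\in T_pM$ such that $u$ is an eigenvector of every $A_{N_\alpha}$ and, for every $\alpha$, all vectors of $T_pM$ orthogonal to $u$ satisfy $A_{N_\alpha}X=\lambda_\alpha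 X$ with one real number $\lambda_\alpha$ (an eigenvalue of multiplicity at least $n-1$ with the same distinguished eigendirection $u$ for all $\alpha$); (ii) the normal connection is trivial (flat), i.e. $R^\perp=0$; (iii) at each $p\in M$ there are an orthonormal basis $e_1,\dots,e_n$ of $T_pM$ and an orthonormal basis $e_{n+1},\dots,e_m$ of the normal space $T_p^\perp M$ such that, with respect to $e_1,\dots,e_n$, $$A_{e_{n+1}}=\operatorname{diag}\Bigl(a,\dots,a,\tfrac{n(n-1)}{r}\,a\Bigr)\ \text{ for some }a\in\mathbb R,\qquad A_{e_{n+2}}=\cdots=A_{e_m}=0$$ (no condition if $m=n$). -/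

import Mathlib

set_option maxSynthPendingDepth 3

open scoped Manifold ContDiff Bundle Topology InnerProductSpace

noncomputable section

namespace Casorati

section LocalCalculus

/-! ### Riemannian calculus in coordinates

`G` is a metric tensor written in coordinates (a field of bilinear forms on the coordinate space),
`F` is a map written in coordinates. -/

variable {E E' : Type*} [NormedAddCommGroup E] [NormedSpace ℝ E]
  [NormedAddCommGroup E'] [NormedSpace ℝ E']

/-- The trilinear form `(u, v, z) ↦ T z u v`. -/
def rotateSlots (T : E →L[ℝ] E →L[ℝ] E →L[ℝ] ℝ) : E →L[ℝ] E →L[ℝ] E →L[ℝ] ℝ :=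
  ContinuousLinearMap.comp
    (ContinuousLinearMap.flipₗᵢ ℝ E E ℝ).toContinuousLinearEquiv.toContinuousLinearMap T.flip

theorem rotateSlots_apply (T : E →L[ℝ] E →L[ℝ] E →L[ℝ] ℝ) (u v z : E) :
    rotateSlots T u v z = T z u v := rfl

/-- The right-hand side of the Koszul formula for constant vector fields `u v z`:
`koszul G x u v z = 1/2 (∂_u G(v, z) + ∂_v G(u, z) - ∂_z G(u, v))` at the point `x`. -/
def koszul (G : E → E →L[ℝ] E →L[ℝ] ℝ) (x : E) : E →L[ℝ] E →L[ℝ] E →L[ℝ] ℝ :=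
  (1 / 2 : ℝ) • (fderiv ℝ G x + (fderiv ℝ G x).flip - rotateSlots (fderiv ℝ G x))

theorem koszul_apply (G : E → E →L[ℝ] E →L[ℝ] ℝ) (x u v z : E) :
    koszul G x u v z =
      1 / 2 * (fderiv ℝ G x u v z + fderiv ℝ G x v u z - fderiv ℝ G x z u v) := by
  simp [koszul, rotateSlots_apply]

/-- The Christoffel symbols of the Levi-Civita connection: `christoffel G x u v` is the vector
`Γ` with `G x Γ z = koszul G x u v z` for all `z`, that is, `∇_u v` for constant fields. -/
def christoffel (G : E → E →L[ℝ] E →L[ℝ] ℝ) (x : E) : E →L[ℝ] E →L[ℝ] E :=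
  ContinuousLinearMap.compL ℝ E (E →L[ℝ] ℝ) E (G x).inverse ∘L koszul G x

/-- The defining property of the Christoffel symbols, when the metric is nondegenerate. -/
theorem apply_christoffel (G : E → E →L[ℝ] E →L[ℝ] ℝ) (x u v z : E)
    (h : (G x).IsInvertible) : G x (christoffel G x u v) z = koszul G x u v z := by
  obtain ⟨e, he⟩ := h
  simp [christoffel, ← he]

/-- `∇_u V` at `x`, where `V` is a vector field along the map `F` and `G` is the metric of the
target of `F`. -/
def covDerivAlong (G : E' → E' →L[ℝ] E' →L[ℝ] ℝ) (F : E → E') (u : E) (V : E → E') (x : E) : E' :=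
  fderiv ℝ V x u + christoffel G (F x) (fderiv ℝ F x u) (V x)

/-- `∇_u W` at `x` for the Levi-Civita connection of `G` and a vector field `W`. -/
def covDeriv (G : E → E →L[ℝ] E →L[ℝ] ℝ) (u : E) (W : E → E) (x : E) : E :=
  covDerivAlong G id u W x

/-- `R(u, v) w = ∇_u ∇_v w - ∇_v ∇_u w` for the (commuting) constant vector fields `u v` and the
constant field `w`. -/
def curvature (G : E → E →L[ℝ] E →L[ℝ] ℝ) (x u v w : E) : E :=
  covDeriv G u (covDeriv G v fun _ => w) x - covDeriv G v (covDeriv G u fun _ => w) x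

/-- The metric induced by `F` from the metric `G` of the target. -/
def inducedMetric (G : E' → E' →L[ℝ] E' →L[ℝ] ℝ) (F : E → E') (x : E) : E →L[ℝ] E →L[ℝ] ℝ :=
  (G (F x)).bilinearComp (fderiv ℝ F x) (fderiv ℝ F x)

/-- The component tangent to `F` of a vector of the target at `F x`: the vector `dF t` with
`G (dF t) (dF z) = G w (dF z)` for all `z`. -/
def tangentialPart (G : E' → E' →L[ℝ] E' →L[ℝ] ℝ) (F : E → E') (x : E) : E' →L[ℝ] E' :=
  fderiv ℝ F x ∘L (inducedMetric G F x).inverse ∘L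
    (G (F x)).bilinearComp (ContinuousLinearMap.id ℝ E') (fderiv ℝ F x)

/-- The component normal to `F` of a vector of the target at `F x`. -/
def normalPart (G : E' → E' →L[ℝ] E' →L[ℝ] ℝ) (F : E → E') (x : E) : E' →L[ℝ] E' :=
  ContinuousLinearMap.id ℝ E' - tangentialPart G F x

/-- The second fundamental form of `F`: the normal part of `∇_u (dF v)` for constant `u v`. -/
def secondFundamentalFormInCoord (G : E' → E' →L[ℝ] E' →L[ℝ] ℝ) (F : E → E') (x : E) :
    E →L[ℝ] E →L[ℝ] E' :=
  ContinuousLinearMap.compL ℝ E E' E' (normalPart G F x) ∘L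
    (fderiv ℝ (fderiv ℝ F) x +
      (christoffel G (F x)).bilinearComp (fderiv ℝ F x) (fderiv ℝ F x))

/-- The normal connection `∇^⊥_u N`. -/
def normalCovDeriv (G : E' → E' →L[ℝ] E' →L[ℝ] ℝ) (F : E → E') (u : E) (N : E → E') (x : E) :
    E' :=
  normalPart G F x (covDerivAlong G F u N x)

/-- The normal curvature `R^⊥(u, v) N = ∇^⊥_u ∇^⊥_v N - ∇^⊥_v ∇^⊥_u N` for the (commuting)
constant vector fields `u v`. -/
def normalCurvature (G : E' → E' →L[ℝ] E' →L[ℝ] ℝ) (F : E → E') (u v : E) (N : E → E') (x : E) :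
    E' :=
  normalCovDeriv G F u (normalCovDeriv G F v N) x - normalCovDeriv G F v (normalCovDeriv G F u N) x

end LocalCalculus

section Intrinsic

/-! ### Riemannian manifolds -/

variable {n : ℕ} {M : Type*} [TopologicalSpace M] [ChartedSpace (EuclideanSpace ℝ (Fin n)) M]

/-- The differential at `p` of the preferred chart at `p`. -/
def chartDiff (p : M) : TangentSpace (𝓡 n) p →L[ℝ] EuclideanSpace ℝ (Fin n) :=
  mfderiv (𝓡 n) 𝓘(ℝ, EuclideanSpace ℝ (Fin n)) (extChartAt (𝓡 n) p) p

/-- The differential at the coordinate vector `x` of the inverse of the preferred chart at `p`. -/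
def chartSymmDiff (p : M) (x : EuclideanSpace ℝ (Fin n)) :
    EuclideanSpace ℝ (Fin n) →L[ℝ] TangentSpace (𝓡 n) ((extChartAt (𝓡 n) p).symm x) :=
  mfderiv 𝓘(ℝ, EuclideanSpace ℝ (Fin n)) (𝓡 n) (extChartAt (𝓡 n) p).symm x

instance instFiniteDimensionalTangentSpace (p : M) :
    FiniteDimensional ℝ (TangentSpace (𝓡 n) p) :=
  inferInstanceAs (FiniteDimensional ℝ (EuclideanSpace ℝ (Fin n)))

variable [Bundle.RiemannianBundle (fun x : M => TangentSpace (𝓡 n) x)]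

/-- The metric tensor in the coordinates of the preferred chart at `p`. -/
def metricInChart (p : M) (x : EuclideanSpace ℝ (Fin n)) :
    EuclideanSpace ℝ (Fin n) →L[ℝ] EuclideanSpace ℝ (Fin n) →L[ℝ] ℝ :=
  (innerSL ℝ (E := TangentSpace (𝓡 n) ((extChartAt (𝓡 n) p).symm x))).bilinearComp
    (chartSymmDiff p x) (chartSymmDiff p x)

/-- The Riemann curvature tensor `R(X, Y, Z, W) = ⟨R(X, Y) Z, W⟩` at `p`. -/
def riemannTensor (p : M) (X Y Z W : TangentSpace (𝓡 n) p) : ℝ :=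
  metricInChart p (extChartAt (𝓡 n) p p)
    (curvature (metricInChart p) (extChartAt (𝓡 n) p p)
      (chartDiff p X) (chartDiff p Y) (chartDiff p Z))
    (chartDiff p W)

/-- The sectional curvature of the plane spanned by the orthonormal vectors `X`, `Y`. -/
def sectionalCurvature (p : M) (X Y : TangentSpace (𝓡 n) p) : ℝ :=
  riemannTensor p X Y Y X

variable (n) in
/-- The scalar curvature `τ(p) = ∑_{i < j} K(e_i ∧ e_j)` for an orthonormal basis `e` of the
tangent space. -/
def scalarCurvature (p : M) : ℝ :=
  ∑ i, ∑ j ∈ Finset.Ioi i,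
    sectionalCurvature p (stdOrthonormalBasis ℝ (TangentSpace (𝓡 n) p) i)
      (stdOrthonormalBasis ℝ (TangentSpace (𝓡 n) p) j)

variable (n) in
/-- The normalized scalar curvature `2 τ(p) / (n (n - 1))`. -/
def normalizedScalarCurvature (p : M) : ℝ :=
  2 * scalarCurvature n p / ((n : ℝ) * ((n : ℝ) - 1))

end Intrinsic

/-- A real space form: all sectional curvatures of the Riemannian manifold `M` equal `c`. -/
def IsRealSpaceForm (n : ℕ) (M : Type*) [TopologicalSpace M]
    [ChartedSpace (EuclideanSpace ℝ (Fin n)) M]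
    [Bundle.RiemannianBundle (fun x : M => TangentSpace (𝓡 n) x)] (c : ℝ) : Prop :=
  ∀ (p : M) (X Y : TangentSpace (𝓡 n) p), Orthonormal ℝ ![X, Y] → sectionalCurvature p X Y = c

section Submanifold

/-! ### Riemannian submanifolds -/

variable {n m : ℕ}
  {M : Type*} [TopologicalSpace M] [ChartedSpace (EuclideanSpace ℝ (Fin n)) M]
  [Bundle.RiemannianBundle (fun x : M => TangentSpace (𝓡 n) x)]
  {M' : Type*} [TopologicalSpace M'] [ChartedSpace (EuclideanSpace ℝ (Fin m)) M']
  [Bundle.RiemannianBundle (fun x : M' => TangentSpace (𝓡 m) x)]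

variable (n m)

/-- `f` is a smooth isometric immersion. (Preservation of the inner products forces the
differentials to be injective.) -/
def IsIsometricImmersion (f : M → M') : Prop :=
  ContMDiff (𝓡 n) (𝓡 m) ∞ f ∧ ∀ (p : M) (X Y : TangentSpace (𝓡 n) p),
    ⟪mfderiv (𝓡 n) (𝓡 m) f p X, mfderiv (𝓡 n) (𝓡 m) f p Y⟫_ℝ = ⟪X, Y⟫_ℝ

/-- The normal space of the immersion `f` at `p`. -/
def normalSpace (f : M → M') (p : M) : Submodule ℝ (TangentSpace (𝓡 m) (f p)) :=
  (mfderiv (𝓡 n) (𝓡 m) f p).rangeᗮ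

/-- The second fundamental form `σ` of the immersion `f` at `p`, with values in the tangent space
of the ambient manifold at `f p`. -/
def secondFundamentalForm (f : M → M') (p : M) :
    TangentSpace (𝓡 n) p →L[ℝ] TangentSpace (𝓡 n) p →L[ℝ] TangentSpace (𝓡 m) (f p) :=
  ContinuousLinearMap.compL ℝ (TangentSpace (𝓡 n) p) (EuclideanSpace ℝ (Fin m))
      (TangentSpace (𝓡 m) (f p)) (chartDiff (f p)).inverse ∘L
    (secondFundamentalFormInCoord (metricInChart (f p)) (writtenInExtChartAt (𝓡 n) (𝓡 m) p f)
      (extChartAt (𝓡 n) p p)).bilinearComp (chartDiff p) (chartDiff p)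

/-- The shape operator `A_N`, determined by `⟨A_N X, Y⟩ = ⟨σ(X, Y), N⟩`. -/
def shapeOperator (f : M → M') (p : M) (N : TangentSpace (𝓡 m) (f p)) :
    TangentSpace (𝓡 n) p →L[ℝ] TangentSpace (𝓡 n) p :=
  InnerProductSpace.continuousLinearMapOfBilin
    (ContinuousLinearMap.compL ℝ (TangentSpace (𝓡 n) p) (TangentSpace (𝓡 m) (f p)) ℝ
      (innerSL ℝ N) ∘L secondFundamentalForm n m f p)

theorem inner_shapeOperator (f : M → M') (p : M) (N : TangentSpace (𝓡 m) (f p))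
    (X Y : TangentSpace (𝓡 n) p) :
    ⟪shapeOperator n m f p N X, Y⟫_ℝ = ⟪N, secondFundamentalForm n m f p X Y⟫_ℝ := by
  simp [shapeOperator]

/-- The Casorati curvature `C(S) = (1/k) ∑_{i,j} ‖σ(e_i, e_j)‖²` of a `k`-dimensional subspace `S`
of the tangent space at `p`, for an orthonormal basis `e` of `S`. -/
def casoratiOfSubspace (f : M → M') (p : M) (S : Submodule ℝ (TangentSpace (𝓡 n) p)) : ℝ :=
  1 / (Module.finrank ℝ S : ℝ) *
    ∑ i, ∑ j, ‖secondFundamentalForm n m f p (stdOrthonormalBasis ℝ S i : TangentSpace (𝓡 n) p)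
      (stdOrthonormalBasis ℝ S j : TangentSpace (𝓡 n) p)‖ ^ 2

/-- The Casorati curvature `C = (1/n) ‖σ‖²` at `p`. -/
def casorati (f : M → M') (p : M) : ℝ :=
  1 / (n : ℝ) * ∑ i, ∑ j, ‖secondFundamentalForm n m f p
      (stdOrthonormalBasis ℝ (TangentSpace (𝓡 n) p) i)
      (stdOrthonormalBasis ℝ (TangentSpace (𝓡 n) p) j)‖ ^ 2

/-- The values `C(Π)` for the hyperplanes `Π` of the tangent space at `p`. -/
def hyperplaneCasorati (f : M → M') (p : M) : Set ℝ :=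
  {t | ∃ S : Submodule ℝ (TangentSpace (𝓡 n) p), Module.finrank ℝ S + 1 = n ∧
    casoratiOfSubspace n m f p S = t}

/-- The coefficient `a(r) = (n - 1) (n + r) (n² - n - r) / (n r)`. -/
def coeff (n : ℕ) (r : ℝ) : ℝ :=
  1 / ((n : ℝ) * r) * ((n : ℝ) - 1) * ((n : ℝ) + r) * ((n : ℝ) ^ 2 - n - r)

/-- The normalized `δ`-Casorati curvature `δ_C(r; n-1)` at `p`, used for `0 < r < n (n - 1)`. -/
def deltaCasorati (f : M → M') (r : ℝ) (p : M) : ℝ :=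
  r * casorati n m f p + coeff n r * sInf (hyperplaneCasorati n m f p)

/-- The normalized `δ`-Casorati curvature `δ̂_C(r; n-1)` at `p`, used for `n (n - 1) < r`. -/
def deltaHatCasorati (f : M → M') (r : ℝ) (p : M) : ℝ :=
  r * casorati n m f p + coeff n r * sSup (hyperplaneCasorati n m f p)

/-- Invariantly quasi-umbilical at every point: there are `m - n` mutually orthogonal unit normal
vectors whose shape operators have an eigenvalue of multiplicity at least `n - 1`, with the same
distinguished eigendirection `u` (the orthogonal complement of `u` consists of eigenvectors). -/
def IsInvariantlyQuasiUmbilical (f : M → M') : Prop :=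
  ∀ p : M, ∃ (N : Fin (m - n) → TangentSpace (𝓡 m) (f p)) (u : TangentSpace (𝓡 n) p),
    Orthonormal ℝ N ∧ (∀ α, N α ∈ normalSpace n m f p) ∧ ‖u‖ = 1 ∧
    ∀ α, ∃ l k : ℝ, shapeOperator n m f p (N α) u = k • u ∧
      ∀ X : TangentSpace (𝓡 n) p, ⟪u, X⟫_ℝ = 0 → shapeOperator n m f p (N α) X = l • X

/-- The normal connection is trivial (flat): `R^⊥(u, v) N = 0` at every point `p`, for all tangent
vectors `u v` and all local smooth normal fields `N` around `p`. In the preferred charts at `p` and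
`f p`, a normal field is a smooth map with values orthogonal to the image of the differential. -/
def HasTrivialNormalConnection (f : M → M') : Prop :=
  ∀ (p : M) (N : EuclideanSpace ℝ (Fin n) → EuclideanSpace ℝ (Fin m)),
    ContDiffAt ℝ ∞ N (extChartAt (𝓡 n) p p) →
    (∀ᶠ x in 𝓝 (extChartAt (𝓡 n) p p), ∀ z,
      metricInChart (f p) (writtenInExtChartAt (𝓡 n) (𝓡 m) p f x) (N x)
        (fderiv ℝ (writtenInExtChartAt (𝓡 n) (𝓡 m) p f) x z) = 0) →
    ∀ u v, normalCurvature (metricInChart (f p)) (writtenInExtChartAt (𝓡 n) (𝓡 m) p f) u v N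
      (extChartAt (𝓡 n) p p) = 0

/-- At every point `p` there are an orthonormal basis `e_1, …, e_n` of the tangent space and an
orthonormal basis `e_{n+1}, …, e_m` of the normal space in which
`A_{n+1} = diag(a, …, a, n (n - 1) a / r)` for some real `a` and `A_{n+2} = ⋯ = A_m = 0`
(no condition if `m = n`). -/
def HasCasoratiIdealShape (f : M → M') (r : ℝ) : Prop :=
  ∀ p : M, ∃ (e : OrthonormalBasis (Fin n) ℝ (TangentSpace (𝓡 n) p))
    (N : OrthonormalBasis (Fin (m - n)) ℝ (normalSpace n m f p)) (a : ℝ),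
    ∀ α : Fin (m - n),
      LinearMap.toMatrix e.toBasis e.toBasis
          (shapeOperator n m f p (N α : TangentSpace (𝓡 m) (f p))).toLinearMap =
        if (α : ℕ) = 0 then
          Matrix.diagonal fun i : Fin n => if (i : ℕ) + 1 = n then (n : ℝ) * (n - 1) / r * a else a
        else 0

end Submanifold

end Casorati

end

noncomputable section

namespace Casorati

section CoordinateCalculus

variable {E E' : Type*} [NormedAddCommGroup E] [NormedSpace ℝ E]
  [NormedAddCommGroup E'] [NormedSpace ℝ E']

/-- The curvature of the connection with Christoffel symbols `Γ`. -/
def connectionCurvature (Γ : E → E →L[ℝ] E →L[ℝ] E) (y a b w : E) : E :=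
  fderiv ℝ Γ y a b w - fderiv ℝ Γ y b a w + Γ y a (Γ y b w) - Γ y b (Γ y a w)

theorem hasFDerivAt_covDerivAlong (G : E' → E' →L[ℝ] E' →L[ℝ] ℝ) (F : E → E') (V : E → E')
    (x : E) (hΓ : DifferentiableAt ℝ (christoffel G) (F x)) (hF : ContDiffAt ℝ 2 F x)
    (hV : ContDiffAt ℝ 2 V x) (u v : E) :
    DifferentiableAt ℝ (covDerivAlong G F v V) x ∧
    fderiv ℝ (covDerivAlong G F v V) x u = fderiv ℝ (fderiv ℝ V) x u v +
      (fderiv ℝ (christoffel G) (F x) (fderiv ℝ F x u) (fderiv ℝ F x v) (V x) +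
        christoffel G (F x) (fderiv ℝ (fderiv ℝ F) x u v) (V x) +
        christoffel G (F x) (fderiv ℝ F x v) (fderiv ℝ V x u)) := by
  have hF1 : HasFDerivAt F (fderiv ℝ F x) x := (hF.differentiableAt (by norm_num)).hasFDerivAt
  have hV1 : HasFDerivAt V (fderiv ℝ V x) x := (hV.differentiableAt (by norm_num)).hasFDerivAt
  have hF2 : HasFDerivAt (fderiv ℝ F) (fderiv ℝ (fderiv ℝ F) x) x :=
    ((hF.fderiv_right (m := 1) (by norm_num)).differentiableAt (by norm_num)).hasFDerivAt
  have hV2 : HasFDerivAt (fderiv ℝ V) (fderiv ℝ (fderiv ℝ V) x) x :=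
    ((hV.fderiv_right (m := 1) (by norm_num)).differentiableAt (by norm_num)).hasFDerivAt
  have hG : HasFDerivAt (fun x' => christoffel G (F x')) _ x := hΓ.hasFDerivAt.comp x hF1
  have h := (hV2.clm_apply (hasFDerivAt_const v x)).add
    ((hG.clm_apply (hF2.clm_apply (hasFDerivAt_const v x))).clm_apply hV1)
  refine ⟨h.differentiableAt, ?_⟩
  have h' := h.fderiv
  change fderiv ℝ (covDerivAlong G F v V) x = _ at h'
  rw [h']
  simp
  abel

theorem covDerivAlong_commutator (G : E' → E' →L[ℝ] E' →L[ℝ] ℝ) (F : E → E') (V : E → E')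
    (x : E) (hΓ : DifferentiableAt ℝ (christoffel G) (F x)) (hF : ContDiffAt ℝ 2 F x)
    (hV : ContDiffAt ℝ 2 V x) (u v : E) :
    covDerivAlong G F u (covDerivAlong G F v V) x - covDerivAlong G F v (covDerivAlong G F u V) x =
      connectionCurvature (christoffel G) (F x) (fderiv ℝ F x u) (fderiv ℝ F x v) (V x) := by
  have h2 : fderiv ℝ (fderiv ℝ F) x u v = fderiv ℝ (fderiv ℝ F) x v u :=
    (hF.isSymmSndFDerivAt (by simp)).eq _ _
  have h3 : fderiv ℝ (fderiv ℝ V) x u v = fderiv ℝ (fderiv ℝ V) x v u :=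
    (hV.isSymmSndFDerivAt (by simp)).eq _ _
  have hD : ∀ u W, covDerivAlong G F u W x =
    fderiv ℝ W x u + christoffel G (F x) (fderiv ℝ F x u) (W x) := fun _ _ => rfl
  rw [hD u, hD v (covDerivAlong G F u V), (hasFDerivAt_covDerivAlong G F V x hΓ hF hV u v).2,
    (hasFDerivAt_covDerivAlong G F V x hΓ hF hV v u).2, h2, h3]
  simp only [covDerivAlong, connectionCurvature, map_add]
  abel

theorem curvature_eq (G : E → E →L[ℝ] E →L[ℝ] ℝ) (x u v w : E)
    (hΓ : DifferentiableAt ℝ (christoffel G) x) :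
    curvature G x u v w = connectionCurvature (christoffel G) x u v w := by
  exact (covDerivAlong_commutator G id (fun _ => w) x hΓ contDiffAt_id contDiffAt_const u v).trans
    (by simp)

/-- `G` is a Riemannian metric of class `C^2` around `y`. -/
structure IsMetricAt (G : E → E →L[ℝ] E →L[ℝ] ℝ) (y : E) : Prop where
  contDiffAt : ContDiffAt ℝ 2 G y
  symm_nhds : ∀ᶠ z in 𝓝 y, ∀ u v, G z u v = G z v u
  pos_nhds : ∀ᶠ z in 𝓝 y, ∀ v, v ≠ 0 → 0 < G z v v

namespace IsMetricAt

variable {G : E → E →L[ℝ] E →L[ℝ] ℝ} {y : E}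

theorem eventually (h : IsMetricAt G y) : ∀ᶠ z in 𝓝 y, IsMetricAt G z := by
  filter_upwards [h.contDiffAt.eventually (by simp), h.symm_nhds.eventually_nhds,
    h.pos_nhds.eventually_nhds] with z h1 h2 h3 using ⟨h1, h2, h3⟩

theorem symm (h : IsMetricAt G y) (u v : E) : G y u v = G y v u := h.symm_nhds.self_of_nhds u v

theorem pos (h : IsMetricAt G y) {v : E} (hv : v ≠ 0) : 0 < G y v v :=
  h.pos_nhds.self_of_nhds v hv

theorem eq_zero (h : IsMetricAt G y) {v : E} (hv : G y v v = 0) : v = 0 := by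
  by_contra hne
  exact (h.pos hne).ne' hv

theorem eq_of_forall (h : IsMetricAt G y) {v w : E} (hv : ∀ z, G y v z = G y w z) : v = w := by
  rw [← sub_eq_zero]
  exact h.eq_zero (by simp [hv])

theorem isInvertible [FiniteDimensional ℝ E] (h : IsMetricAt G y) : (G y).IsInvertible := by
  have hinj : Function.Injective (G y).toLinearMap := fun v w hvw =>
    h.eq_of_forall fun z => DFunLike.congr_fun hvw z
  have hdim : Module.finrank ℝ E = Module.finrank ℝ (E →L[ℝ] ℝ) := by
    rw [← (LinearMap.toContinuousLinearMap (E := E) (F' := ℝ) (𝕜 := ℝ)).finrank_eq]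
    exact (Subspace.dual_finrank_eq).symm
  refine ⟨(LinearEquiv.ofInjectiveOfFinrankEq _ hinj hdim).toContinuousLinearEquiv, ?_⟩
  ext v w
  rfl

theorem differentiableAt (h : IsMetricAt G y) : DifferentiableAt ℝ G y :=
  h.contDiffAt.differentiableAt (by norm_num)

theorem fderiv_symm (h : IsMetricAt G y) (u v w : E) :
    fderiv ℝ G y u v w = fderiv ℝ G y u w v := by
  have key : ∀ a b : E, fderiv ℝ (fun z => G z a b) y u = fderiv ℝ G y u a b := fun a b => by
    rw [fderiv_clm_apply (h.differentiableAt.clm_apply (differentiableAt_const a))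
      (differentiableAt_const b), fderiv_clm_apply h.differentiableAt (differentiableAt_const a)]
    simp
  rw [← key, ← key]
  congr 1
  apply Filter.EventuallyEq.fderiv_eq
  filter_upwards [h.symm_nhds] with z hz using hz v w

theorem differentiableAt_christoffel [FiniteDimensional ℝ E] (h : IsMetricAt G y) :
    DifferentiableAt ℝ (christoffel G) y := by
  have h1 : DifferentiableAt ℝ (fderiv ℝ G) y :=
    (h.contDiffAt.fderiv_right (m := 1) (by norm_num)).differentiableAt (by norm_num)
  have hflip : DifferentiableAt ℝ (fun z => (fderiv ℝ G z).flip) y :=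
    (ContinuousLinearMap.flipₗᵢ ℝ E E (E →L[ℝ] ℝ)).toContinuousLinearEquiv.differentiableAt.comp
      y h1
  have hrot : DifferentiableAt ℝ (fun z => rotateSlots (fderiv ℝ G z)) y :=
    (differentiableAt_const _).clm_comp hflip
  have hk : DifferentiableAt ℝ (koszul G) y := by
    unfold koszul
    exact ((h1.add hflip).sub hrot).const_smul (1 / 2 : ℝ)
  have hinv : DifferentiableAt ℝ (fun z => (G z).inverse) y :=
    (h.isInvertible.contDiffAt_map_inverse (n := 1)).differentiableAt (by norm_num) |>.comp y
      h.differentiableAt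
  have hc : DifferentiableAt ℝ (fun z => ContinuousLinearMap.compL ℝ E (E →L[ℝ] ℝ) E
      (G z).inverse) y :=
    (ContinuousLinearMap.compL ℝ E (E →L[ℝ] ℝ) E).differentiableAt.comp y hinv
  exact hc.clm_comp hk

variable [FiniteDimensional ℝ E]

theorem apply_christoffel (h : IsMetricAt G y) (u v z : E) :
    G y (christoffel G y u v) z = koszul G y u v z :=
  Casorati.apply_christoffel G y u v z h.isInvertible

theorem christoffel_symm (h : IsMetricAt G y) (u v : E) :
    christoffel G y u v = christoffel G y v u := by
  refine h.eq_of_forall fun z => ?_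
  rw [h.apply_christoffel, h.apply_christoffel, koszul_apply, koszul_apply, h.fderiv_symm z u v]
  ring

theorem fderiv_eq_christoffel (h : IsMetricAt G y) (u v w : E) :
    fderiv ℝ G y u v w = G y (christoffel G y u v) w + G y v (christoffel G y u w) := by
  rw [h.symm v, h.apply_christoffel, h.apply_christoffel, koszul_apply, koszul_apply,
    h.fderiv_symm w u v, h.fderiv_symm u v w, h.fderiv_symm w v u, h.fderiv_symm v u w]
  ring

theorem fderiv_christoffel_symm (h : IsMetricAt G y) (u v w : E) :
    fderiv ℝ (christoffel G) y u v w = fderiv ℝ (christoffel G) y u w v := by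
  have hd := h.differentiableAt_christoffel
  have key : ∀ a b : E, fderiv ℝ (fun z => christoffel G z a b) y u =
      fderiv ℝ (christoffel G) y u a b := fun a b => by
    rw [fderiv_clm_apply (hd.clm_apply (differentiableAt_const a))
      (differentiableAt_const b), fderiv_clm_apply hd (differentiableAt_const a)]
    simp
  rw [← key, ← key]
  congr 1
  apply Filter.EventuallyEq.fderiv_eq
  filter_upwards [h.eventually] with z hz using hz.christoffel_symm v w

end IsMetricAt

end CoordinateCalculus

section ConstantCurvature

/-- A curvature-like tensor with vanishing sectional curvatures vanishes. -/
theorem eq_zero_of_sectional_eq_zero {E : Type*} [AddCommGroup E] (Q : E → E → E → E → ℝ)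
    (hadd : ∀ a a' b w z, Q (a + a') b w z = Q a b w z + Q a' b w z)
    (h12 : ∀ a b w z, Q a b w z = -Q b a w z) (h34 : ∀ a b w z, Q a b w z = -Q a b z w)
    (hB : ∀ a b w z, Q a b w z + Q b w a z + Q w a b z = 0)
    (h0 : ∀ a b, Q a b b a = 0) (a b w z : E) : Q a b w z = 0 := by
  have hpair : ∀ a b w z, Q a b w z = Q w z a b := fun a b w z => by
    linarith [hB a b w z, hB b w z a, hB w z a b, hB z a b w, h12 a b w z, h12 b w z a,
      h34 a b w z, h34 b w a z, h34 w a b z, h34 w z a b, h34 z a b w, h34 a w z b, h12 w z a b,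
      h12 z a b w, h34 b w z a, h34 z b w a, h12 z b w a, h34 w a z b, h12 a w z b, h34 z b a w,
      h12 w a z b, h12 b z a w, h34 b z w a, h34 a w b z, h34 a z w b, h12 a z w b, h12 b z w a]
  have hadd2 : ∀ a b b' w z, Q a (b + b') w z = Q a b w z + Q a b' w z := fun a b b' w z => by
    rw [h12, hadd, h12 a b, h12 a b']; ring
  have hadd3 : ∀ a b w w' z, Q a b (w + w') z = Q a b w z + Q a b w' z := fun a b w w' z => by
    rw [hpair, hadd, hpair w, hpair w']
  have hadd4 : ∀ a b w z z', Q a b w (z + z') = Q a b w z + Q a b w z' := fun a b w z z' => by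
    rw [hpair, hadd2, hpair _ z, hpair _ z']
  have h1 : ∀ a b z, Q a b b z = 0 := fun a b z => by
    have h := h0 (a + z) b
    rw [hadd, hadd4, hadd4, h0, h0, hpair z b b a, h12 b a z b, h34 a b z b] at h
    linarith
  have h2 : ∀ a b w z, Q a b w z = -Q a w b z := fun a b w z => by
    have h := h1 a (b + w) z
    rw [hadd2, hadd3, hadd3, h1, h1] at h
    linarith
  linarith [hB a b w z, h2 a b w z, h2 b w a z, h12 b a w z, h12 w a b z]

variable {E E' : Type*} [NormedAddCommGroup E] [NormedSpace ℝ E]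
  [NormedAddCommGroup E'] [NormedSpace ℝ E']

/-- Compatibility of the Levi-Civita connection with the metric. -/
theorem hasFDerivAt_metric_along [FiniteDimensional ℝ E'] {G : E' → E' →L[ℝ] E' →L[ℝ] ℝ}
    {F : E → E'} {V W : E → E'} {x : E} (hG : IsMetricAt G (F x)) (hF : DifferentiableAt ℝ F x)
    (hV : DifferentiableAt ℝ V x) (hW : DifferentiableAt ℝ W x) (u : E) :
    DifferentiableAt ℝ (fun x' => G (F x') (V x') (W x')) x ∧
    fderiv ℝ (fun x' => G (F x') (V x') (W x')) x u =
      G (F x) (covDerivAlong G F u V x) (W x) + G (F x) (V x) (covDerivAlong G F u W x) := by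
  have h1 : HasFDerivAt (fun x' => G (F x')) _ x :=
    hG.differentiableAt.hasFDerivAt.comp x hF.hasFDerivAt
  have h := (h1.clm_apply hV.hasFDerivAt).clm_apply hW.hasFDerivAt
  refine ⟨h.differentiableAt, ?_⟩
  rw [h.fderiv]
  simp [covDerivAlong, hG.fderiv_eq_christoffel]
  ring

theorem connectionCurvature_bianchi [FiniteDimensional ℝ E] {G : E → E →L[ℝ] E →L[ℝ] ℝ} {y : E}
    (hG : IsMetricAt G y) (a b w : E) :
    connectionCurvature (christoffel G) y a b w + connectionCurvature (christoffel G) y b w a +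
      connectionCurvature (christoffel G) y w a b = 0 := by
  simp only [connectionCurvature]
  rw [hG.fderiv_christoffel_symm a b w, hG.fderiv_christoffel_symm b w a,
    hG.fderiv_christoffel_symm w a b, hG.christoffel_symm b w, hG.christoffel_symm a w,
    hG.christoffel_symm b a]
  abel

theorem connectionCurvature_antisymm [FiniteDimensional ℝ E] {G : E → E →L[ℝ] E →L[ℝ] ℝ} {y : E}
    (hG : IsMetricAt G y) (a b w z : E) :
    G y (connectionCurvature (christoffel G) y a b w) z =
      -G y (connectionCurvature (christoffel G) y a b z) w := by
  set φ : E → ℝ := fun x => G x w z with hφ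
  have hφ2 : ContDiffAt ℝ 2 φ y :=
    (hG.contDiffAt.clm_apply contDiffAt_const).clm_apply contDiffAt_const
  have hΓ := hG.differentiableAt_christoffel
  have hsymm : fderiv ℝ (fderiv ℝ φ) y a b = fderiv ℝ (fderiv ℝ φ) y b a :=
    (hφ2.isSymmSndFDerivAt (by simp)).eq _ _
  have hD : ∀ (v t : E), DifferentiableAt ℝ (covDerivAlong G id v fun _ => t) y := fun v t =>
    (hasFDerivAt_covDerivAlong G id (fun _ => t) y hΓ contDiffAt_id contDiffAt_const v v).1
  have hsnd : ∀ u v, fderiv ℝ (fderiv ℝ φ) y u v =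
      G y (covDerivAlong G id u (covDerivAlong G id v fun _ => w) y) z +
      G y (covDerivAlong G id v (fun _ => w) y) (covDerivAlong G id u (fun _ => z) y) +
      (G y (covDerivAlong G id u (fun _ => w) y) (covDerivAlong G id v (fun _ => z) y) +
      G y w (covDerivAlong G id u (covDerivAlong G id v fun _ => z) y)) := by
    intro u v
    have h1 : fderiv ℝ (fderiv ℝ φ) y u v = fderiv ℝ (fun x => fderiv ℝ φ x v) y u := by
      rw [fderiv_clm_apply ((hφ2.fderiv_right (m := 1) (by norm_num)).differentiableAt
        (by norm_num)) (differentiableAt_const v)]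
      simp
    have h2 : (fun x => fderiv ℝ φ x v) =ᶠ[𝓝 y] fun x =>
        G (id x) (covDerivAlong G id v (fun _ => w) x) z +
          G (id x) w (covDerivAlong G id v (fun _ => z) x) := by
      filter_upwards [hG.eventually] with x hx
      exact (hasFDerivAt_metric_along (F := id) (V := fun _ => w) (W := fun _ => z) hx
        differentiableAt_id (differentiableAt_const _) (differentiableAt_const _) v).2
    have h3 := hasFDerivAt_metric_along (F := id) (W := fun _ => z) hG differentiableAt_id
      (hD v w) (differentiableAt_const z) u
    have h4 := hasFDerivAt_metric_along (F := id) (V := fun _ => w) hG differentiableAt_id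
      (differentiableAt_const w) (hD v z) u
    rw [h1, h2.fderiv_eq, fderiv_fun_add h3.1 h4.1, add_apply, h3.2, h4.2]
    rfl
  rw [hsnd, hsnd] at hsymm
  have hw := covDerivAlong_commutator G id (fun _ => w) y hΓ contDiffAt_id contDiffAt_const a b
  have hz := covDerivAlong_commutator G id (fun _ => z) y hΓ contDiffAt_id contDiffAt_const a b
  simp only [fderiv_id, id, ContinuousLinearMap.id_apply] at hw hz
  rw [← hw, ← hz, hG.symm _ w]
  simp only [map_sub, sub_apply]
  linarith

/-- The curvature tensor of a metric whose sectional curvatures at a point all equal `c`. -/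
theorem connectionCurvature_eq_of_sectional_eq [FiniteDimensional ℝ E]
    {G : E → E →L[ℝ] E →L[ℝ] ℝ} {y : E} (hG : IsMetricAt G y) {c : ℝ}
    (hc : ∀ a b, G y a a = 1 → G y b b = 1 → G y a b = 0 →
      G y (connectionCurvature (christoffel G) y a b b) a = c) (a b w : E) :
    connectionCurvature (christoffel G) y a b w = c • (G y b w • a - G y a w • b) := by
  refine hG.eq_of_forall fun z => ?_
  set R := connectionCurvature (christoffel G) y with hR
  have hadd : ∀ a a' b w, R (a + a') b w = R a b w + R a' b w := fun a a' b w => by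
    simp only [hR, connectionCurvature, map_add, add_apply]; abel
  have hsmul : ∀ (t : ℝ) a b w, R (t • a) b w = t • R a b w := fun t a b w => by
    simp only [hR, connectionCurvature, map_smul, smul_apply, smul_sub,
      smul_add]
  have h12 : ∀ a b w, R a b w = -R b a w := fun a b w => by
    simp only [hR, connectionCurvature]; abel
  have h34 : ∀ a b w z, G y (R a b w) z = -G y (R a b z) w := connectionCurvature_antisymm hG
  have hB : ∀ a b w, R a b w + R b w a + R w a b = 0 := connectionCurvature_bianchi hG
  have hsmul3 : ∀ (t : ℝ) a b w, R a b (t • w) = t • R a b w := fun t a b w => by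
    simp only [hR, connectionCurvature, map_smul, smul_sub, smul_add]
  have hadd3 : ∀ a b w w', R a b (w + w') = R a b w + R a b w' := fun a b w w' => by
    simp only [hR, connectionCurvature, map_add]; abel
  have hself : ∀ a w, R a a w = 0 := fun a w => by
    simp only [hR, connectionCurvature]; abel
  have hself' : ∀ a b w, G y (R a b w) w = 0 := fun a b w => by linarith [h34 a b w w]
  have hsec : ∀ a b, G y (R a b b) a = c * (G y a a * G y b b - G y a b * G y a b) := by
    intro a b
    by_cases ha : a = 0
    · subst ha; simp
    set μ := G y a b / G y a a with hμ
    have haa : 0 < G y a a := hG.pos ha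
    have horth : G y a (b - μ • a) = 0 := by
      simp only [map_sub, map_smul, smul_eq_mul, hμ]; field_simp; ring
    obtain ⟨b', hb'⟩ : ∃ b', b' = b - μ • a := ⟨_, rfl⟩
    have hb : b = b' + μ • a := by rw [hb']; abel
    rw [← hb'] at horth
    have h1 : G y (R a b b) a = G y (R a b' b') a := by
      rw [hb, h12 a, hadd, hsmul, hself, hadd3, hsmul3, smul_zero, add_zero, h12 a]
      simp [hself']
    have h2 : G y a a * G y b b - G y a b * G y a b = G y a a * G y b' b' := by
      rw [hb]
      simp only [map_add, map_smul, add_apply, smul_apply,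
        smul_eq_mul, horth, hG.symm b' a]
      ring
    rw [h1, h2]
    by_cases hb0 : b' = 0
    · subst hb0
      have : R a 0 0 = 0 := by have := hsmul3 0 a 0 0; simpa using this
      simp [this]
    have hbb : 0 < G y b' b' := hG.pos hb0
    have hsa := Real.mul_self_sqrt haa.le
    have hsb := Real.mul_self_sqrt hbb.le
    have hsa0 : 0 < √(G y a a) := Real.sqrt_pos.2 haa
    have hsb0 : 0 < √(G y b' b') := Real.sqrt_pos.2 hbb
    set s := √(G y a a)
    set t := √(G y b' b')
    have h := hc (s⁻¹ • a) (t⁻¹ • b') (by simp [← hsa]; field_simp) (by simp [← hsb]; field_simp)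
      (by simp [horth])
    change G y (R _ _ _) _ = c at h
    rw [hsmul, hsmul3, h12, hsmul, h12] at h
    simp only [map_smul, smul_apply, smul_eq_mul, smul_neg, neg_neg] at h
    rw [← hsa, ← hsb, ← h]
    field_simp
  have := eq_zero_of_sectional_eq_zero
    (fun a b w z => G y (R a b w) z - c * (G y b w * G y a z - G y a w * G y b z))
    (fun a a' b w z => by
      simp only [hadd, map_add, add_apply]; ring)
    (fun a b w z => by
      simp only [h12 a b, map_neg, neg_apply]; ring)
    (fun a b w z => by
      simp only [h34 a b w z]; ring)
    (fun a b w z => by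
      have h := congrArg (fun v => G y v z) (hB a b w)
      simp only [map_add, add_apply, map_zero,
        zero_apply] at h
      simp only [hG.symm b w, hG.symm w a, hG.symm b a]
      linarith)
    (fun a b => by simp only [hsec, hG.symm b a]; ring) a b w z
  simp only [map_smul, map_sub, smul_apply, sub_apply,
    smul_eq_mul]
  linarith

end ConstantCurvature

section Submanifolds

variable {E E' : Type*} [NormedAddCommGroup E] [NormedSpace ℝ E]
  [NormedAddCommGroup E'] [NormedSpace ℝ E']

theorem covDerivAlong_add (G : E' → E' →L[ℝ] E' →L[ℝ] ℝ) (F : E → E') {V W : E → E'} {x : E}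
    (hV : DifferentiableAt ℝ V x) (hW : DifferentiableAt ℝ W x) (u : E) :
    covDerivAlong G F u (fun x' => V x' + W x') x =
      covDerivAlong G F u V x + covDerivAlong G F u W x := by
  simp only [covDerivAlong, fderiv_fun_add hV hW, add_apply, map_add]
  abel

theorem covDerivAlong_sub (G : E' → E' →L[ℝ] E' →L[ℝ] ℝ) (F : E → E') {V W : E → E'} {x : E}
    (hV : DifferentiableAt ℝ V x) (hW : DifferentiableAt ℝ W x) (u : E) :
    covDerivAlong G F u (fun x' => V x' - W x') x =
      covDerivAlong G F u V x - covDerivAlong G F u W x := by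
  simp only [covDerivAlong, fderiv_fun_sub hV hW, sub_apply, map_sub]
  abel

theorem covDerivAlong_congr (G : E' → E' →L[ℝ] E' →L[ℝ] ℝ) (F : E → E') {V W : E → E'} {x : E}
    (h : V =ᶠ[𝓝 x] W) (u : E) : covDerivAlong G F u V x = covDerivAlong G F u W x := by
  simp only [covDerivAlong, h.fderiv_eq, h.self_of_nhds]

/-- `F` is an immersion of class `C^3` around `x` into a space with the metric `G`. -/
structure IsImmersionAt (G : E' → E' →L[ℝ] E' →L[ℝ] ℝ) (F : E → E') (x : E) : Prop where
  metric : IsMetricAt G (F x)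
  contDiffAt : ContDiffAt ℝ 3 F x
  injective_nhds : ∀ᶠ x' in 𝓝 x, Function.Injective (fderiv ℝ F x')

theorem inducedMetric_apply (G : E' → E' →L[ℝ] E' →L[ℝ] ℝ) (F : E → E') (x u v : E) :
    inducedMetric G F x u v = G (F x) (fderiv ℝ F x u) (fderiv ℝ F x v) := rfl

/-- The coordinates of the tangential part. -/
def tangentialCoeff (G : E' → E' →L[ℝ] E' →L[ℝ] ℝ) (F : E → E') (x : E) (w : E') : E :=
  (inducedMetric G F x).inverse ((G (F x) w).comp (fderiv ℝ F x))

theorem normalPart_eq (G : E' → E' →L[ℝ] E' →L[ℝ] ℝ) (F : E → E') (x : E) (w : E') :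
    normalPart G F x w = w - fderiv ℝ F x (tangentialCoeff G F x w) := rfl

namespace IsImmersionAt

variable {G : E' → E' →L[ℝ] E' →L[ℝ] ℝ} {F : E → E'} {x : E}

theorem differentiableAt (h : IsImmersionAt G F x) : DifferentiableAt ℝ F x :=
  h.contDiffAt.differentiableAt (by norm_num)

theorem contDiffAt_fderiv (h : IsImmersionAt G F x) : ContDiffAt ℝ 2 (fderiv ℝ F) x :=
  h.contDiffAt.fderiv_right (m := 2) (by norm_num)

theorem differentiableAt_fderiv (h : IsImmersionAt G F x) : DifferentiableAt ℝ (fderiv ℝ F) x :=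
  h.contDiffAt_fderiv.differentiableAt (by norm_num)

theorem injective (h : IsImmersionAt G F x) : Function.Injective (fderiv ℝ F x) :=
  h.injective_nhds.self_of_nhds

theorem eventually (h : IsImmersionAt G F x) : ∀ᶠ x' in 𝓝 x, IsImmersionAt G F x' := by
  filter_upwards [h.differentiableAt.continuousAt.eventually h.metric.eventually,
    h.contDiffAt.eventually (by simp), h.injective_nhds.eventually_nhds] with z h1 h2 h3
    using ⟨h1, h2, h3⟩

theorem isMetricAt_inducedMetric (h : IsImmersionAt G F x) :
    IsMetricAt (inducedMetric G F) x := by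
  have hd := h.contDiffAt_fderiv
  have hG : ContDiffAt ℝ 2 (fun z => G (F z)) x :=
    h.metric.contDiffAt.comp x (h.contDiffAt.of_le (by norm_num))
  refine ⟨?_, ?_, ?_⟩
  · have h1 := hG.clm_comp hd
    have h2 : ContDiffAt ℝ 2 (fun z => ((G (F z)).comp (fderiv ℝ F z)).flip) x :=
      (ContinuousLinearMap.flipₗᵢ ℝ E E' ℝ).toContinuousLinearEquiv.contDiff.contDiffAt.comp x h1
    have h3 := h2.clm_comp hd
    exact (ContinuousLinearMap.flipₗᵢ ℝ E E ℝ).toContinuousLinearEquiv.contDiff.contDiffAt.comp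
      x h3
  · filter_upwards [h.eventually] with z hz u v using hz.metric.symm _ _
  · filter_upwards [h.eventually] with z hz v hv
    exact hz.metric.pos fun h0 => hv (hz.injective (h0.trans (map_zero _).symm))

theorem contDiffAt_tangent (h : IsImmersionAt G F x) (v : E) :
    ContDiffAt ℝ 2 (fun x' => fderiv ℝ F x' v) x :=
  h.contDiffAt_fderiv.clm_apply contDiffAt_const

theorem covDerivAlong_tangent (h : IsImmersionAt G F x) (u v : E) :
    covDerivAlong G F u (fun x' => fderiv ℝ F x' v) x =
      fderiv ℝ (fderiv ℝ F) x u v + christoffel G (F x) (fderiv ℝ F x u) (fderiv ℝ F x v) := by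
  rw [covDerivAlong, fderiv_clm_apply h.differentiableAt_fderiv (differentiableAt_const v)]
  simp

theorem secondFundamentalFormInCoord_eq (h : IsImmersionAt G F x) (u v : E) :
    secondFundamentalFormInCoord G F x u v =
      normalPart G F x (covDerivAlong G F u (fun x' => fderiv ℝ F x' v) x) := by
  rw [h.covDerivAlong_tangent]
  rfl

variable [FiniteDimensional ℝ E]

theorem inducedMetric_tangentialCoeff (h : IsImmersionAt G F x) (w : E') (z : E) :
    inducedMetric G F x (tangentialCoeff G F x w) z = G (F x) w (fderiv ℝ F x z) := by
  obtain ⟨e, he⟩ := h.isMetricAt_inducedMetric.isInvertible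
  simp [tangentialCoeff, ← he]

theorem apply_normalPart (h : IsImmersionAt G F x) (w : E') (z : E) :
    G (F x) (normalPart G F x w) (fderiv ℝ F x z) = 0 := by
  rw [normalPart_eq, map_sub, sub_apply, ← inducedMetric_apply, h.inducedMetric_tangentialCoeff,
    sub_self]

theorem tangentialCoeff_eq (h : IsImmersionAt G F x) {w : E'} {t : E}
    (hw : ∀ z, G (F x) w (fderiv ℝ F x z) = inducedMetric G F x t z) :
    tangentialCoeff G F x w = t :=
  h.isMetricAt_inducedMetric.eq_of_forall fun z => by
    rw [h.inducedMetric_tangentialCoeff, hw]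

theorem normalPart_of_normal (h : IsImmersionAt G F x) {w : E'}
    (hw : ∀ z, G (F x) w (fderiv ℝ F x z) = 0) : normalPart G F x w = w := by
  rw [normalPart_eq, h.tangentialCoeff_eq (t := 0) (by simp [hw]), map_zero, sub_zero]

theorem normalPart_tangent (h : IsImmersionAt G F x) (t : E) :
    normalPart G F x (fderiv ℝ F x t) = 0 := by
  have ht : tangentialCoeff G F x (fderiv ℝ F x t) = t := h.tangentialCoeff_eq fun z => rfl
  rw [normalPart_eq, ht, sub_self]

theorem apply_secondFundamentalFormInCoord (h : IsImmersionAt G F x) (u v z : E) :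
    G (F x) (secondFundamentalFormInCoord G F x u v) (fderiv ℝ F x z) = 0 :=
  h.apply_normalPart _ z

omit [FiniteDimensional ℝ E] in
theorem covDerivAlong_tangent_symm [FiniteDimensional ℝ E'] (h : IsImmersionAt G F x) (u v : E) :
    covDerivAlong G F u (fun x' => fderiv ℝ F x' v) x =
      covDerivAlong G F v (fun x' => fderiv ℝ F x' u) x := by
  rw [h.covDerivAlong_tangent, h.covDerivAlong_tangent, h.metric.christoffel_symm,
    ((h.contDiffAt.of_le (m := 2) (by norm_num)).isSymmSndFDerivAt (by simp)).eq u v]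

omit [FiniteDimensional ℝ E] in
theorem secondFundamentalFormInCoord_symm [FiniteDimensional ℝ E'] (h : IsImmersionAt G F x) (u v : E) :
    secondFundamentalFormInCoord G F x u v = secondFundamentalFormInCoord G F x v u := by
  rw [h.secondFundamentalFormInCoord_eq, h.secondFundamentalFormInCoord_eq,
    h.covDerivAlong_tangent_symm]

variable [FiniteDimensional ℝ E']

/-- The formula of Gauss. -/
theorem gauss_formula (h : IsImmersionAt G F x) (u v : E) :
    covDerivAlong G F u (fun x' => fderiv ℝ F x' v) x =
      fderiv ℝ F x (christoffel (inducedMetric G F) x u v) +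
        secondFundamentalFormInCoord G F x u v := by
  have hg := h.isMetricAt_inducedMetric
  have hd : ∀ v, DifferentiableAt ℝ (fun x' => fderiv ℝ F x' v) x := fun v =>
    (h.contDiffAt_tangent v).differentiableAt (by norm_num)
  have key : ∀ u v z, fderiv ℝ (inducedMetric G F) x u v z =
      G (F x) (covDerivAlong G F u (fun x' => fderiv ℝ F x' v) x) (fderiv ℝ F x z) +
        G (F x) (fderiv ℝ F x v) (covDerivAlong G F u (fun x' => fderiv ℝ F x' z) x) := by
    intro u v z
    rw [← (hasFDerivAt_metric_along h.metric h.differentiableAt (hd v) (hd z) u).2]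
    have h1 : fderiv ℝ (fun x' => inducedMetric G F x' v z) x u =
        fderiv ℝ (inducedMetric G F) x u v z := by
      rw [fderiv_clm_apply (hg.differentiableAt.clm_apply (differentiableAt_const v))
        (differentiableAt_const z), fderiv_clm_apply hg.differentiableAt (differentiableAt_const v)]
      simp
    rw [← h1]
    rfl
  have hc : tangentialCoeff G F x (covDerivAlong G F u (fun x' => fderiv ℝ F x' v) x) =
      christoffel (inducedMetric G F) x u v := by
    refine h.tangentialCoeff_eq fun z => ?_
    rw [hg.apply_christoffel, koszul_apply, key, key, key, h.covDerivAlong_tangent_symm v u,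
      h.covDerivAlong_tangent_symm z u, h.covDerivAlong_tangent_symm z v,
      h.metric.symm (fderiv ℝ F x v), h.metric.symm (fderiv ℝ F x u)]
    ring
  rw [h.secondFundamentalFormInCoord_eq, normalPart_eq, hc]
  abel

theorem covDerivAlong_tangent_field (h : IsImmersionAt G F x) {B : E → E}
    (hB : DifferentiableAt ℝ B x) (u : E) :
    covDerivAlong G F u (fun x' => fderiv ℝ F x' (B x')) x =
      fderiv ℝ F x (covDeriv (inducedMetric G F) u B x) +
        secondFundamentalFormInCoord G F x u (B x) := by
  have h1 := h.gauss_formula u (B x)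
  rw [h.covDerivAlong_tangent] at h1
  rw [covDerivAlong, fderiv_clm_apply h.differentiableAt_fderiv hB]
  simp only [add_apply, ContinuousLinearMap.comp_apply, ContinuousLinearMap.flip_apply]
  rw [add_assoc, h1]
  simp [covDeriv, covDerivAlong]
  abel

theorem apply_covDerivAlong_of_normal (h : IsImmersionAt G F x) {N : E → E'}
    (hN : DifferentiableAt ℝ N x)
    (hperp : ∀ᶠ x' in 𝓝 x, ∀ z, G (F x') (N x') (fderiv ℝ F x' z) = 0) (u z : E) :
    G (F x) (covDerivAlong G F u N x) (fderiv ℝ F x z) =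
      -G (F x) (N x) (secondFundamentalFormInCoord G F x u z) := by
  have h1 := (hasFDerivAt_metric_along h.metric h.differentiableAt hN
    ((h.contDiffAt_tangent z).differentiableAt (by norm_num)) u).2
  have h2 : (fun x' => G (F x') (N x') (fderiv ℝ F x' z)) =ᶠ[𝓝 x] fun _ => 0 := by
    filter_upwards [hperp] with x' hx' using hx' z
  rw [h2.fderiv_eq, h.gauss_formula, map_add, hperp.self_of_nhds] at h1
  simp at h1
  linarith

/-- The Gauss equation. -/
theorem gauss_equation (h : IsImmersionAt G F x) (u v w z : E) :
    inducedMetric G F x (curvature (inducedMetric G F) x u v w) z =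
      G (F x) (connectionCurvature (christoffel G) (F x) (fderiv ℝ F x u) (fderiv ℝ F x v)
        (fderiv ℝ F x w)) (fderiv ℝ F x z) +
      G (F x) (secondFundamentalFormInCoord G F x v w) (secondFundamentalFormInCoord G F x u z) -
      G (F x) (secondFundamentalFormInCoord G F x u w)
        (secondFundamentalFormInCoord G F x v z) := by
  have hg := h.isMetricAt_inducedMetric
  have hF2 : ContDiffAt ℝ 2 F x := h.contDiffAt.of_le (by norm_num)
  have hΓ := h.metric.differentiableAt_christoffel
  have key : ∀ u v, G (F x) (covDerivAlong G F u
      (covDerivAlong G F v fun x' => fderiv ℝ F x' w) x) (fderiv ℝ F x z) =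
      inducedMetric G F x (covDeriv (inducedMetric G F) u
        (covDeriv (inducedMetric G F) v fun _ => w) x) z -
      G (F x) (secondFundamentalFormInCoord G F x v w)
        (secondFundamentalFormInCoord G F x u z) := by
    intro u v
    set B : E → E := covDeriv (inducedMetric G F) v fun _ => w with hBdef
    have hBx : ∀ x', B x' = christoffel (inducedMetric G F) x' v w := fun x' => by
      simp [hBdef, covDeriv, covDerivAlong]
    have hB : DifferentiableAt ℝ B x :=
      (hasFDerivAt_covDerivAlong (inducedMetric G F) id (fun _ => w) x
        hg.differentiableAt_christoffel contDiffAt_id contDiffAt_const v v).1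
    have hV := (hasFDerivAt_covDerivAlong G F (fun x' => fderiv ℝ F x' w) x hΓ hF2
      (h.contDiffAt_tangent w) v v).1
    have hT : DifferentiableAt ℝ (fun x' => fderiv ℝ F x' (B x')) x :=
      h.differentiableAt_fderiv.clm_apply hB
    set N : E → E' := fun x' => covDerivAlong G F v (fun x' => fderiv ℝ F x' w) x' -
      fderiv ℝ F x' (B x') with hNdef
    have hN : DifferentiableAt ℝ N x := hV.sub hT
    have hNeq : ∀ᶠ x' in 𝓝 x, N x' = secondFundamentalFormInCoord G F x' v w := by
      filter_upwards [h.eventually] with x' hx'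
      simp only [hNdef]
      rw [hBx, hx'.gauss_formula v w, add_sub_cancel_left]
    have hperp : ∀ᶠ x' in 𝓝 x, ∀ z, G (F x') (N x') (fderiv ℝ F x' z) = 0 := by
      filter_upwards [hNeq, h.eventually] with x' h1 h2 z
      rw [h1, h2.apply_secondFundamentalFormInCoord]
    have hsum : covDerivAlong G F u (covDerivAlong G F v fun x' => fderiv ℝ F x' w) x =
        covDerivAlong G F u (fun x' => fderiv ℝ F x' (B x')) x + covDerivAlong G F u N x := by
      rw [← covDerivAlong_add G F hT hN]
      congr 1
      funext x'
      simp [hNdef]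
    rw [hsum, h.covDerivAlong_tangent_field hB, map_add, map_add, add_apply, add_apply,
      h.apply_secondFundamentalFormInCoord, h.apply_covDerivAlong_of_normal hN hperp,
      hNeq.self_of_nhds, inducedMetric_apply]
    ring
  rw [← covDerivAlong_commutator G F _ x hΓ hF2 (h.contDiffAt_tangent w), map_sub, sub_apply,
    key, key, curvature, map_sub, sub_apply]
  ring

/-- The Ricci equation. -/
theorem ricci_equation (h : IsImmersionAt G F x) {N : E → E'} (hN : ContDiffAt ℝ 2 N x)
    (hperp : ∀ᶠ x' in 𝓝 x, ∀ z, G (F x') (N x') (fderiv ℝ F x' z) = 0) :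
    ∃ B : E → E, (∀ v z, inducedMetric G F x (B v) z =
        -G (F x) (N x) (secondFundamentalFormInCoord G F x v z)) ∧
      ∀ u v, normalCurvature G F u v N x =
        normalPart G F x (connectionCurvature (christoffel G) (F x) (fderiv ℝ F x u)
          (fderiv ℝ F x v) (N x)) -
        secondFundamentalFormInCoord G F x u (B v) +
        secondFundamentalFormInCoord G F x v (B u) := by
  have hg := h.isMetricAt_inducedMetric
  have hF2 : ContDiffAt ℝ 2 F x := h.contDiffAt.of_le (by norm_num)
  have hΓ := h.metric.differentiableAt_christoffel
  have hD := fun v => (hasFDerivAt_covDerivAlong G F N x hΓ hF2 hN v v).1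
  set B : E → E → E := fun v x' => tangentialCoeff G F x' (covDerivAlong G F v N x') with hBdef
  have hB : ∀ v, DifferentiableAt ℝ (B v) x := by
    intro v
    have hinv : DifferentiableAt ℝ (fun z => (inducedMetric G F z).inverse) x :=
      (hg.isInvertible.contDiffAt_map_inverse (n := 1)).differentiableAt (by norm_num) |>.comp x
        hg.differentiableAt
    have hG : DifferentiableAt ℝ (fun z => G (F z)) x :=
      h.metric.differentiableAt.comp x h.differentiableAt
    exact hinv.clm_apply ((hG.clm_apply (hD v)).clm_comp h.differentiableAt_fderiv)
  have hN1 : DifferentiableAt ℝ N x := hN.differentiableAt (by norm_num)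
  refine ⟨fun v => B v x, fun v z => ?_, fun u v => ?_⟩
  · rw [h.inducedMetric_tangentialCoeff, h.apply_covDerivAlong_of_normal hN1 hperp]
  · have key : ∀ u v, normalCovDeriv G F u (normalCovDeriv G F v N) x =
        normalPart G F x (covDerivAlong G F u (covDerivAlong G F v N) x) -
          secondFundamentalFormInCoord G F x u (B v x) := by
      intro u v
      have h1 : normalCovDeriv G F v N = fun x' => covDerivAlong G F v N x' -
          fderiv ℝ F x' (B v x') := rfl
      rw [normalCovDeriv, h1, covDerivAlong_sub G F (hD v)
        (h.differentiableAt_fderiv.clm_apply (hB v)), h.covDerivAlong_tangent_field (hB v),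
        map_sub, map_add, h.normalPart_tangent, zero_add,
        h.normalPart_of_normal fun z => h.apply_secondFundamentalFormInCoord _ _ z]
    rw [normalCurvature, key, key, ← covDerivAlong_commutator G F N x hΓ hF2 hN, map_sub]
    abel

/-- In a space of constant curvature, the normal connection is flat at a point where all
shape operators are multiples of one self-adjoint operator. -/
theorem normalCurvature_eq_zero (h : IsImmersionAt G F x) {c : ℝ}
    (hc : ∀ a b w, connectionCurvature (christoffel G) (F x) a b w =
      c • (G (F x) b w • a - G (F x) a w • b)) {N : E → E'} (hN : ContDiffAt ℝ 2 N x)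
    (hperp : ∀ᶠ x' in 𝓝 x, ∀ z, G (F x') (N x') (fderiv ℝ F x' z) = 0) {ξ : E'} {L : E → E}
    (hL : ∀ u v, secondFundamentalFormInCoord G F x u v = inducedMetric G F x (L u) v • ξ)
    (u v : E) : normalCurvature G F u v N x = 0 := by
  have hg := h.isMetricAt_inducedMetric
  obtain ⟨B, hB, hR⟩ := h.ricci_equation hN hperp
  have hBL : ∀ v, B v = -(G (F x) (N x) ξ) • L v := fun v => hg.eq_of_forall fun z => by
    rw [hB, hL]
    simp
    ring
  rw [hR, hc, h.metric.symm _ (N x), h.metric.symm _ (N x), hperp.self_of_nhds,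
    hperp.self_of_nhds, hBL, hBL, hL, hL]
  simp [hg.symm (L u) (L v)]

end IsImmersionAt

end Submanifolds

section Charts

variable {n : ℕ} {M : Type*} [TopologicalSpace M] [ChartedSpace (EuclideanSpace ℝ (Fin n)) M]

theorem chartDiff_apply [IsManifold (𝓡 n) ∞ M] (p : M) (X : TangentSpace (𝓡 n) p) :
    @Eq (EuclideanSpace ℝ (Fin n)) (chartDiff p X) X := by
  rw [chartDiff, mfderiv_extChartAt_self]
  rfl

theorem chartSymmDiff_eq_symmL [IsManifold (𝓡 n) ∞ M] (p : M) {x : EuclideanSpace ℝ (Fin n)}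
    (hx : x ∈ (extChartAt (𝓡 n) p).target) :
    chartSymmDiff p x = (trivializationAt (EuclideanSpace ℝ (Fin n)) (TangentSpace (𝓡 n)) p).symmL ℝ
      ((extChartAt (𝓡 n) p).symm x) := by
  have h1 : (extChartAt (𝓡 n) p).symm x ∈ (chartAt (EuclideanSpace ℝ (Fin n)) p).source := by
    rw [← extChartAt_source (𝓡 n)]
    exact (extChartAt (𝓡 n) p).map_target hx
  rw [TangentBundle.symmL_trivializationAt h1, (extChartAt (𝓡 n) p).right_inv hx,
    ModelWithCorners.range_eq_univ, mfderivWithin_univ]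
  rfl

theorem chartSymmDiff_injective [IsManifold (𝓡 n) ∞ M] (p : M) {x : EuclideanSpace ℝ (Fin n)}
    (hx : x ∈ (extChartAt (𝓡 n) p).target) : Function.Injective (chartSymmDiff p x) := by
  have h := isInvertible_mfderivWithin_extChartAt_symm hx
  rw [ModelWithCorners.range_eq_univ, mfderivWithin_univ] at h
  obtain ⟨e, he⟩ := h
  intro v w hvw
  apply e.injective
  change mfderiv _ _ _ _ v = mfderiv _ _ _ _ w at hvw
  rw [← he] at hvw
  exact hvw

variable [Bundle.RiemannianBundle (fun x : M => TangentSpace (𝓡 n) x)]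

theorem inner_congr_point {p q : M} (h : p = q) (v w : EuclideanSpace ℝ (Fin n)) :
    inner ℝ (show TangentSpace (𝓡 n) p from v) (show TangentSpace (𝓡 n) p from w) =
      inner ℝ (show TangentSpace (𝓡 n) q from v) (show TangentSpace (𝓡 n) q from w) := by
  subst h; rfl

theorem metricInChart_apply (p : M) (x u v : EuclideanSpace ℝ (Fin n)) :
    metricInChart p x u v = ⟪chartSymmDiff p x u, chartSymmDiff p x v⟫_ℝ := rfl

variable [IsManifold (𝓡 n) ∞ M]
  [IsContMDiffRiemannianBundle (𝓡 n) ∞ (EuclideanSpace ℝ (Fin n))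
    (fun x : M => TangentSpace (𝓡 n) x)]

theorem contDiffOn_metricInChart (p : M) :
    ContDiffOn ℝ ∞ (metricInChart p) (extChartAt (𝓡 n) p).target := by
  rw [contDiffOn_clm_apply]
  intro u
  rw [contDiffOn_clm_apply]
  intro v
  rw [← contMDiffOn_iff_contDiffOn]
  have hsymm : ContMDiffOn 𝓘(ℝ, EuclideanSpace ℝ (Fin n)) (𝓡 n) ∞ (extChartAt (𝓡 n) p).symm
      (extChartAt (𝓡 n) p).target := contMDiffOn_extChartAt_symm p
  have hfield : ∀ u : EuclideanSpace ℝ (Fin n),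
      ContMDiffOn 𝓘(ℝ, EuclideanSpace ℝ (Fin n)) ((𝓡 n).prod 𝓘(ℝ, EuclideanSpace ℝ (Fin n))) ∞
        (fun x => (⟨(extChartAt (𝓡 n) p).symm x, chartSymmDiff p x u⟩ :
          Bundle.TotalSpace (EuclideanSpace ℝ (Fin n)) (TangentSpace (𝓡 n) : M → Type _)))
        (extChartAt (𝓡 n) p).target := by
    intro u
    set e := trivializationAt (EuclideanSpace ℝ (Fin n)) (TangentSpace (𝓡 n) : M → Type _) p
    have hmem : ∀ x ∈ (extChartAt (𝓡 n) p).target,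
        (extChartAt (𝓡 n) p).symm x ∈ e.baseSet := fun x hx => by
      rw [TangentBundle.trivializationAt_baseSet, ← extChartAt_source (𝓡 n)]
      exact (extChartAt (𝓡 n) p).map_target hx
    have h2 := (Bundle.Trivialization.contMDiffOn_symm (n := ∞) (IB := 𝓡 n) e).comp
      (hsymm.prodMk (contMDiffOn_const (c := u)))
      (fun x hx => by simpa [e.mem_target] using hmem x hx)
    refine h2.congr fun x hx => ?_
    rw [chartSymmDiff_eq_symmL p hx]
    rw [Function.comp_apply, ← Bundle.Trivialization.mk_symm e (hmem x hx) u,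
      Bundle.Trivialization.symmL_apply _ (hmem x hx)]
  exact ContMDiffOn.inner_bundle (hfield u) (hfield v)

theorem isMetricAt_metricInChart (p : M) {x : EuclideanSpace ℝ (Fin n)}
    (hx : x ∈ (extChartAt (𝓡 n) p).target) : IsMetricAt (metricInChart p) x := by
  have hopen : IsOpen (extChartAt (𝓡 n) p).target := isOpen_extChartAt_target p
  refine ⟨((contDiffOn_metricInChart p).contDiffAt (hopen.mem_nhds hx)).of_le
    ENat.LEInfty.out, ?_, ?_⟩
  · exact Filter.Eventually.of_forall fun z u v => by
      rw [metricInChart_apply, metricInChart_apply, real_inner_comm]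
  · filter_upwards [hopen.mem_nhds hx] with z hz v hv
    rw [metricInChart_apply]
    refine real_inner_self_pos.2 fun h0 => hv (chartSymmDiff_injective p hz ?_)
    exact h0.trans (map_zero _).symm

omit [IsContMDiffRiemannianBundle (𝓡 n) ∞ (EuclideanSpace ℝ (Fin n))
    (fun x : M => TangentSpace (𝓡 n) x)] in
theorem metricInChart_self (p : M) (u v : TangentSpace (𝓡 n) p) :
    metricInChart p (extChartAt (𝓡 n) p p) u v = ⟪u, v⟫_ℝ := by
  have h : chartSymmDiff p (extChartAt (𝓡 n) p p) =
      ContinuousLinearMap.id ℝ (EuclideanSpace ℝ (Fin n)) := by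
    have := mfderivWithin_range_extChartAt_symm (I := 𝓡 n) (x := p)
    rw [ModelWithCorners.range_eq_univ, mfderivWithin_univ] at this
    exact this
  change inner ℝ (chartSymmDiff p (extChartAt (𝓡 n) p p) u)
    (chartSymmDiff p (extChartAt (𝓡 n) p p) v) = _
  rw [h]
  exact inner_congr_point (extChartAt_to_inv p) u v

end Charts

section Immersions

variable {n m : ℕ}
  {M : Type*} [TopologicalSpace M] [ChartedSpace (EuclideanSpace ℝ (Fin n)) M]
  [IsManifold (𝓡 n) ∞ M]
  [Bundle.RiemannianBundle (fun x : M => TangentSpace (𝓡 n) x)]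
  {M' : Type*} [TopologicalSpace M'] [ChartedSpace (EuclideanSpace ℝ (Fin m)) M']
  [IsManifold (𝓡 m) ∞ M']
  [Bundle.RiemannianBundle (fun x : M' => TangentSpace (𝓡 m) x)]

omit [IsManifold (𝓡 n) ∞ M] [IsManifold (𝓡 m) ∞ M'] in
theorem contDiffAt_writtenInExtChartAt {f : M → M'} (hf : IsIsometricImmersion n m f) (p : M) :
    ContDiffAt ℝ ∞ (writtenInExtChartAt (𝓡 n) (𝓡 m) p f) (extChartAt (𝓡 n) p p) := by
  have h := (contMDiffAt_iff.1 (hf.1 p)).2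
  rwa [ModelWithCorners.range_eq_univ, contDiffWithinAt_univ] at h

theorem inducedMetric_eventuallyEq {f : M → M'} (hf : IsIsometricImmersion n m f) (p : M) :
    ∀ᶠ x in 𝓝 (extChartAt (𝓡 n) p p),
      inducedMetric (metricInChart (f p)) (writtenInExtChartAt (𝓡 n) (𝓡 m) p f) x =
        metricInChart p x := by
  have hsrc : ∀ᶠ x in 𝓝 (extChartAt (𝓡 n) p p),
      f ((extChartAt (𝓡 n) p).symm x) ∈ (extChartAt (𝓡 m) (f p)).source := by
    have hc : ContinuousAt (fun x => f ((extChartAt (𝓡 n) p).symm x)) (extChartAt (𝓡 n) p p) := by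
      refine ContinuousAt.comp ?_ (continuousAt_extChartAt_symm p)
      rw [extChartAt_to_inv]
      exact (hf.1 p).continuousAt
    refine hc.eventually_mem ?_
    rw [extChartAt_to_inv]
    exact extChartAt_source_mem_nhds (f p)
  have hF := contDiffAt_writtenInExtChartAt hf p
  have hF1 : ∀ᶠ x in 𝓝 (extChartAt (𝓡 n) p p),
      ContDiffAt ℝ 1 (writtenInExtChartAt (𝓡 n) (𝓡 m) p f) x :=
    (hF.of_le (m := 1) ENat.LEInfty.out).eventually (by simp)
  filter_upwards [hsrc.eventually_nhds, hF1, extChartAt_target_mem_nhds (I := 𝓡 n) p]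
    with x hx hFx hxt
  have hx0 := hx.self_of_nhds
  set F := writtenInExtChartAt (𝓡 n) (𝓡 m) p f with hFdef
  have hFd : DifferentiableAt ℝ F x := hFx.differentiableAt (by norm_num)
  have hFt : F x ∈ (extChartAt (𝓡 m) (f p)).target := (extChartAt (𝓡 m) (f p)).map_source hx0
  have hd1 : MDifferentiableAt 𝓘(ℝ, EuclideanSpace ℝ (Fin n)) (𝓡 n)
      (extChartAt (𝓡 n) p).symm x := by
    have := mdifferentiableWithinAt_extChartAt_symm (I := 𝓡 n) hxt
    rwa [ModelWithCorners.range_eq_univ, mdifferentiableWithinAt_univ] at this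
  have hd2 : MDifferentiableAt 𝓘(ℝ, EuclideanSpace ℝ (Fin m)) (𝓡 m)
      (extChartAt (𝓡 m) (f p)).symm (F x) := by
    have := mdifferentiableWithinAt_extChartAt_symm (I := 𝓡 m) hFt
    rwa [ModelWithCorners.range_eq_univ, mdifferentiableWithinAt_univ] at this
  have hf1 : MDifferentiableAt (𝓡 n) (𝓡 m) f ((extChartAt (𝓡 n) p).symm x) :=
    (hf.1 _).mdifferentiableAt (by simp)
  have heq : (extChartAt (𝓡 m) (f p)).symm ∘ F =ᶠ[𝓝 x] f ∘ (extChartAt (𝓡 n) p).symm := by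
    filter_upwards [hx] with z hz
    exact (extChartAt (𝓡 m) (f p)).left_inv hz
  have hpt : (extChartAt (𝓡 m) (f p)).symm (F x) = f ((extChartAt (𝓡 n) p).symm x) :=
    heq.self_of_nhds
  have h1 := mfderiv_comp x hd2 hFd.mdifferentiableAt
  have h2 := mfderiv_comp x hf1 hd1
  have h3 : mfderiv 𝓘(ℝ, EuclideanSpace ℝ (Fin n)) (𝓡 m) ((extChartAt (𝓡 m) (f p)).symm ∘ F) x =
    mfderiv 𝓘(ℝ, EuclideanSpace ℝ (Fin n)) (𝓡 m) (f ∘ (extChartAt (𝓡 n) p).symm) x :=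
    heq.mfderiv_eq
  have key : ∀ u : EuclideanSpace ℝ (Fin n),
      (show EuclideanSpace ℝ (Fin m) from chartSymmDiff (f p) (F x) (fderiv ℝ F x u)) =
      (show EuclideanSpace ℝ (Fin m) from
        mfderiv (𝓡 n) (𝓡 m) f ((extChartAt (𝓡 n) p).symm x) (chartSymmDiff p x u)) := by
    intro u
    have h4 := (h1.symm.trans h3).trans h2
    rw [mfderiv_eq_fderiv] at h4
    exact congrArg (fun T : EuclideanSpace ℝ (Fin n) →L[ℝ] EuclideanSpace ℝ (Fin m) => T u) h4
  ext u v
  rw [inducedMetric_apply, metricInChart_apply, metricInChart_apply, ← hf.2]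
  refine (inner_congr_point hpt _ _).trans ?_
  exact congrArg₂ (fun a b : EuclideanSpace ℝ (Fin m) =>
    inner ℝ (show TangentSpace (𝓡 m) (f ((extChartAt (𝓡 n) p).symm x)) from a) b) (key u) (key v)

omit [IsManifold (𝓡 n) ∞ M] [IsManifold (𝓡 m) ∞ M'] in
theorem fderiv_writtenInExtChartAt {f : M → M'} (hf : IsIsometricImmersion n m f) (p : M) :
    fderiv ℝ (writtenInExtChartAt (𝓡 n) (𝓡 m) p f) (extChartAt (𝓡 n) p p) =
      mfderiv (𝓡 n) (𝓡 m) f p := by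
  have h := (hf.1 p).mdifferentiableAt (by simp)
  rw [h.mfderiv, ModelWithCorners.range_eq_univ, fderivWithin_univ]

variable [IsContMDiffRiemannianBundle (𝓡 n) ∞ (EuclideanSpace ℝ (Fin n))
    (fun x : M => TangentSpace (𝓡 n) x)]
  [IsContMDiffRiemannianBundle (𝓡 m) ∞ (EuclideanSpace ℝ (Fin m))
    (fun x : M' => TangentSpace (𝓡 m) x)]

theorem isImmersionAt_writtenInExtChartAt {f : M → M'} (hf : IsIsometricImmersion n m f) (p : M) :
    IsImmersionAt (metricInChart (f p)) (writtenInExtChartAt (𝓡 n) (𝓡 m) p f)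
      (extChartAt (𝓡 n) p p) := by
  refine ⟨isMetricAt_metricInChart (f p) ?_,
    (contDiffAt_writtenInExtChartAt hf p).of_le ENat.LEInfty.out, ?_⟩
  · rw [writtenInExtChartAt, Function.comp_apply, Function.comp_apply, extChartAt_to_inv]
    exact mem_extChartAt_target (f p)
  · filter_upwards [inducedMetric_eventuallyEq hf p, extChartAt_target_mem_nhds (I := 𝓡 n) p]
      with x hx hxt v w hvw
    refine (isMetricAt_metricInChart p hxt).eq_of_forall fun z => ?_
    rw [← hx, inducedMetric_apply, inducedMetric_apply, hvw]

end Immersions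

section Congruence

variable {E : Type*} [NormedAddCommGroup E] [NormedSpace ℝ E]

theorem christoffel_congr {G G' : E → E →L[ℝ] E →L[ℝ] ℝ} {x : E} (h : G =ᶠ[𝓝 x] G') :
    christoffel G x = christoffel G' x := by
  simp only [christoffel, koszul, h.fderiv_eq, h.self_of_nhds]

theorem curvature_congr {G G' : E → E →L[ℝ] E →L[ℝ] ℝ} {x : E} (h : G =ᶠ[𝓝 x] G') (u v w : E) :
    curvature G x u v w = curvature G' x u v w := by
  have h1 : ∀ v, covDeriv G v (fun _ => w) =ᶠ[𝓝 x] covDeriv G' v fun _ => w := fun v => by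
    filter_upwards [h.eventuallyEq_nhds] with z hz
    simp [covDeriv, covDerivAlong, christoffel_congr hz]
  have h2 : ∀ u v, covDeriv G u (covDeriv G v fun _ => w) x =
      covDeriv G' u (covDeriv G' v fun _ => w) x := fun u v => by
    rw [covDeriv, covDeriv, covDerivAlong_congr G id (h1 v), covDerivAlong, covDerivAlong, id,
      christoffel_congr h]
  rw [curvature, curvature, h2, h2]

end Congruence

section SpaceForms

variable {m : ℕ} {M' : Type*} [TopologicalSpace M'] [ChartedSpace (EuclideanSpace ℝ (Fin m)) M']
  [IsManifold (𝓡 m) ∞ M']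
  [Bundle.RiemannianBundle (fun x : M' => TangentSpace (𝓡 m) x)]

theorem sectionalCurvature_eq (p : M') (X Y : TangentSpace (𝓡 m) p) :
    sectionalCurvature p X Y = metricInChart p (extChartAt (𝓡 m) p p)
      (curvature (metricInChart p) (extChartAt (𝓡 m) p p) X Y Y) X := by
  rw [sectionalCurvature, riemannTensor, chartDiff_apply, chartDiff_apply]

variable [IsContMDiffRiemannianBundle (𝓡 m) ∞ (EuclideanSpace ℝ (Fin m))
    (fun x : M' => TangentSpace (𝓡 m) x)]

theorem IsRealSpaceForm.connectionCurvature_eq {c : ℝ} (h : IsRealSpaceForm m M' c) (p : M')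
    (a b w : EuclideanSpace ℝ (Fin m)) :
    connectionCurvature (christoffel (metricInChart p)) (extChartAt (𝓡 m) p p) a b w =
      c • (metricInChart p (extChartAt (𝓡 m) p p) b w • a -
        metricInChart p (extChartAt (𝓡 m) p p) a w • b) := by
  have hG := isMetricAt_metricInChart p (mem_extChartAt_target (I := 𝓡 m) p)
  refine connectionCurvature_eq_of_sectional_eq hG (fun a b ha hb hab => ?_) a b w
  have hK := h p a b (by
    rw [orthonormal_iff_ite]
    have ha' := (metricInChart_self p a a).symm.trans ha
    have hb' := (metricInChart_self p b b).symm.trans hb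
    have hab' := (metricInChart_self p a b).symm.trans hab
    have hba' := (real_inner_comm _ _).trans hab'
    intro i j
    fin_cases i <;> fin_cases j
    · exact ha'
    · exact hab'
    · exact hba'
    · exact hb')
  rw [← curvature_eq _ _ _ _ _ hG.differentiableAt_christoffel]
  exact (sectionalCurvature_eq p a b).symm.trans hK

end SpaceForms

section Submanifolds

variable {n m : ℕ}
  {M : Type*} [TopologicalSpace M] [ChartedSpace (EuclideanSpace ℝ (Fin n)) M]
  [IsManifold (𝓡 n) ∞ M]
  [Bundle.RiemannianBundle (fun x : M => TangentSpace (𝓡 n) x)]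
  {M' : Type*} [TopologicalSpace M'] [ChartedSpace (EuclideanSpace ℝ (Fin m)) M']
  [IsManifold (𝓡 m) ∞ M']
  [Bundle.RiemannianBundle (fun x : M' => TangentSpace (𝓡 m) x)]

theorem secondFundamentalForm_apply (f : M → M') (p : M) (X Y : TangentSpace (𝓡 n) p) :
    @Eq (EuclideanSpace ℝ (Fin m)) (secondFundamentalForm n m f p X Y)
      (secondFundamentalFormInCoord (metricInChart (f p)) (writtenInExtChartAt (𝓡 n) (𝓡 m) p f)
        (extChartAt (𝓡 n) p p) X Y) := by
  change (chartDiff (f p)).inverse (secondFundamentalFormInCoord (metricInChart (f p))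
    (writtenInExtChartAt (𝓡 n) (𝓡 m) p f) (extChartAt (𝓡 n) p p) (chartDiff p X)
      (chartDiff p Y)) = _
  rw [chartDiff_apply, chartDiff_apply]
  have h : @Eq (EuclideanSpace ℝ (Fin m) →L[ℝ] EuclideanSpace ℝ (Fin m)) (chartDiff (f p))
      (ContinuousLinearMap.id ℝ (EuclideanSpace ℝ (Fin m))) := mfderiv_extChartAt_self
  have h2 : @Eq (EuclideanSpace ℝ (Fin m) →L[ℝ] EuclideanSpace ℝ (Fin m))
      (chartDiff (f p)).inverse (ContinuousLinearMap.id ℝ (EuclideanSpace ℝ (Fin m))) :=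
    (congrArg ContinuousLinearMap.inverse h).trans ContinuousLinearMap.inverse_id
  exact DFunLike.congr_fun h2 _

omit [IsManifold (𝓡 n) ∞ M] [IsManifold (𝓡 m) ∞ M']
  [Bundle.RiemannianBundle (fun x : M => TangentSpace (𝓡 n) x)]
  [Bundle.RiemannianBundle (fun x : M' => TangentSpace (𝓡 m) x)] in
theorem writtenInExtChartAt_self (f : M → M') (p : M) :
    writtenInExtChartAt (𝓡 n) (𝓡 m) p f (extChartAt (𝓡 n) p p) =
      extChartAt (𝓡 m) (f p) (f p) := by
  rw [writtenInExtChartAt, Function.comp_apply, Function.comp_apply, extChartAt_to_inv]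

omit [IsManifold (𝓡 n) ∞ M] [Bundle.RiemannianBundle (fun x : M => TangentSpace (𝓡 n) x)] in
theorem metricInChart_writtenInExtChartAt (f : M → M') (p : M)
    (v w : TangentSpace (𝓡 m) (f p)) :
    metricInChart (f p) (writtenInExtChartAt (𝓡 n) (𝓡 m) p f (extChartAt (𝓡 n) p p)) v w =
      ⟪v, w⟫_ℝ := by
  rw [writtenInExtChartAt_self]
  exact metricInChart_self (f p) v w

variable [IsContMDiffRiemannianBundle (𝓡 n) ∞ (EuclideanSpace ℝ (Fin n))
    (fun x : M => TangentSpace (𝓡 n) x)]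
  [IsContMDiffRiemannianBundle (𝓡 m) ∞ (EuclideanSpace ℝ (Fin m))
    (fun x : M' => TangentSpace (𝓡 m) x)]

theorem secondFundamentalForm_symm {f : M → M'} (hf : IsIsometricImmersion n m f) (p : M)
    (X Y : TangentSpace (𝓡 n) p) :
    secondFundamentalForm n m f p X Y = secondFundamentalForm n m f p Y X :=
  (secondFundamentalForm_apply f p X Y).trans
    (((isImmersionAt_writtenInExtChartAt hf p).secondFundamentalFormInCoord_symm X Y).trans
      (secondFundamentalForm_apply f p Y X).symm)

theorem secondFundamentalForm_mem_normalSpace {f : M → M'} (hf : IsIsometricImmersion n m f)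
    (p : M) (X Y : TangentSpace (𝓡 n) p) :
    secondFundamentalForm n m f p X Y ∈ normalSpace n m f p := by
  rw [normalSpace, Submodule.mem_orthogonal']
  rintro _ ⟨Z, rfl⟩
  rw [← metricInChart_writtenInExtChartAt (n := n) f p, secondFundamentalForm_apply]
  have := (isImmersionAt_writtenInExtChartAt hf p).apply_secondFundamentalFormInCoord X Y Z
  rw [fderiv_writtenInExtChartAt hf p] at this
  exact this

/-- The Gauss equation for sectional curvatures. -/
theorem sectionalCurvature_eq_add {c : ℝ} (hM' : IsRealSpaceForm m M' c) {f : M → M'}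
    (hf : IsIsometricImmersion n m f) (p : M) {X Y : TangentSpace (𝓡 n) p}
    (hX : ‖X‖ = 1) (hY : ‖Y‖ = 1) (hXY : ⟪X, Y⟫_ℝ = 0) :
    sectionalCurvature p X Y = c +
      ⟪secondFundamentalForm n m f p X X, secondFundamentalForm n m f p Y Y⟫_ℝ -
      ‖secondFundamentalForm n m f p X Y‖ ^ 2 := by
  have h := isImmersionAt_writtenInExtChartAt hf p
  have hg := inducedMetric_eventuallyEq hf p
  have hg0 := hg.self_of_nhds
  have hcurv := hM'.connectionCurvature_eq (f p)
  rw [← writtenInExtChartAt_self (n := n) f p] at hcurv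
  have key : ∀ x y : EuclideanSpace ℝ (Fin n),
      metricInChart p (extChartAt (𝓡 n) p p) x x = 1 →
      metricInChart p (extChartAt (𝓡 n) p p) y y = 1 →
      metricInChart p (extChartAt (𝓡 n) p p) x y = 0 →
      metricInChart p (extChartAt (𝓡 n) p p)
        (curvature (metricInChart p) (extChartAt (𝓡 n) p p) x y y) x =
      c + metricInChart (f p) (writtenInExtChartAt (𝓡 n) (𝓡 m) p f (extChartAt (𝓡 n) p p))
          (secondFundamentalFormInCoord (metricInChart (f p))
            (writtenInExtChartAt (𝓡 n) (𝓡 m) p f) (extChartAt (𝓡 n) p p) x x)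
          (secondFundamentalFormInCoord (metricInChart (f p))
            (writtenInExtChartAt (𝓡 n) (𝓡 m) p f) (extChartAt (𝓡 n) p p) y y) -
        metricInChart (f p) (writtenInExtChartAt (𝓡 n) (𝓡 m) p f (extChartAt (𝓡 n) p p))
          (secondFundamentalFormInCoord (metricInChart (f p))
            (writtenInExtChartAt (𝓡 n) (𝓡 m) p f) (extChartAt (𝓡 n) p p) x y)
          (secondFundamentalFormInCoord (metricInChart (f p))
            (writtenInExtChartAt (𝓡 n) (𝓡 m) p f) (extChartAt (𝓡 n) p p) x y) := by
    intro x y hx hy hxy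
    have hgauss := h.gauss_equation x y y x
    rwa [hcurv, ← inducedMetric_apply, ← inducedMetric_apply, curvature_congr hg, hg0, hy, hxy,
      zero_smul, sub_zero, one_smul, map_smul, smul_apply, ← inducedMetric_apply, hg0, hx,
      smul_eq_mul, mul_one, h.secondFundamentalFormInCoord_symm y x, 
      h.metric.symm (secondFundamentalFormInCoord _ _ _ y y)] at hgauss
  have hσ : ∀ X Y Z W : TangentSpace (𝓡 n) p,
      metricInChart (f p) (writtenInExtChartAt (𝓡 n) (𝓡 m) p f (extChartAt (𝓡 n) p p))
        (secondFundamentalFormInCoord (metricInChart (f p))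
          (writtenInExtChartAt (𝓡 n) (𝓡 m) p f) (extChartAt (𝓡 n) p p) X Y)
        (secondFundamentalFormInCoord (metricInChart (f p))
          (writtenInExtChartAt (𝓡 n) (𝓡 m) p f) (extChartAt (𝓡 n) p p) Z W) =
      ⟪secondFundamentalForm n m f p X Y, secondFundamentalForm n m f p Z W⟫_ℝ :=
    fun X Y Z W => (congrArg₂ (fun a b => metricInChart (f p) (writtenInExtChartAt (𝓡 n) (𝓡 m) p f
      (extChartAt (𝓡 n) p p)) a b) (secondFundamentalForm_apply f p X Y).symm
      (secondFundamentalForm_apply f p Z W).symm).trans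
      (metricInChart_writtenInExtChartAt (n := n) f p _ _)
  refine (sectionalCurvature_eq p X Y).trans ((key X Y ?_ ?_ ?_).trans ?_)
  · exact (metricInChart_self p X X).trans (by rw [real_inner_self_eq_norm_sq, hX, one_pow])
  · exact (metricInChart_self p Y Y).trans (by rw [real_inner_self_eq_norm_sq, hY, one_pow])
  · exact (metricInChart_self p X Y).trans hXY
  · rw [← real_inner_self_eq_norm_sq]
    exact congrArg₂ (fun s t => c + s - t) (hσ X X Y Y) (hσ X Y X Y)

theorem hasTrivialNormalConnection_of_forall {c : ℝ} (hM' : IsRealSpaceForm m M' c) {f : M → M'}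
    (hf : IsIsometricImmersion n m f)
    (h : ∀ p : M, ∃ (ξ : TangentSpace (𝓡 m) (f p))
      (L : TangentSpace (𝓡 n) p → TangentSpace (𝓡 n) p),
      ∀ X Y, secondFundamentalForm n m f p X Y = ⟪L X, Y⟫_ℝ • ξ) :
    HasTrivialNormalConnection n m f := by
  intro p N hN hperp u v
  obtain ⟨ξ, L, hL⟩ := h p
  have hcurv := hM'.connectionCurvature_eq (f p)
  rw [← writtenInExtChartAt_self (n := n) f p] at hcurv
  refine (isImmersionAt_writtenInExtChartAt hf p).normalCurvature_eq_zero hcurv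
    (hN.of_le ENat.LEInfty.out) hperp (ξ := ξ) (L := L) (fun X Y => ?_) u v
  have h1 := (secondFundamentalForm_apply f p X Y).symm.trans (hL X Y)
  rw [(inducedMetric_eventuallyEq hf p).self_of_nhds]
  refine h1.trans ?_
  rw [← metricInChart_self p (L X) Y]
  rfl

end Submanifolds

section BasisIndependence

variable {V W : Type*} [NormedAddCommGroup V] [InnerProductSpace ℝ V] {ι κ : Type*} [Fintype ι]
  [Fintype κ]

theorem sum_bilin_orthonormalBasis [AddCommGroup W] [Module ℝ W] (B : V →ₗ[ℝ] V →ₗ[ℝ] W)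
    (b : OrthonormalBasis ι ℝ V) (b' : OrthonormalBasis κ ℝ V) :
    ∑ i, B (b i) (b i) = ∑ k, B (b' k) (b' k) := by
  classical
  have h1 : ∀ i, B (b i) (b i) = ∑ k, ∑ l, (⟪b' k, b i⟫_ℝ * ⟪b i, b' l⟫_ℝ) • B (b' k) (b' l) := by
    intro i
    conv_lhs => rw [← b'.sum_repr' (b i)]
    simp only [map_sum, map_smul, LinearMap.sum_apply, LinearMap.smul_apply, Finset.smul_sum,
      smul_smul]
    rw [Finset.sum_comm]
    refine Finset.sum_congr rfl fun k _ => Finset.sum_congr rfl fun l _ => ?_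
    rw [real_inner_comm (b i) (b' l), mul_comm]
  simp only [h1]
  rw [Finset.sum_comm]
  refine Finset.sum_congr rfl fun k _ => ?_
  rw [Finset.sum_comm]
  simp only [← Finset.sum_smul, b.sum_inner_mul_inner, orthonormal_iff_ite.1 b'.orthonormal]
  simp

variable [NormedAddCommGroup W] [InnerProductSpace ℝ W]

theorem sum_norm_sq_orthonormalBasis (T : V →L[ℝ] W) (b : OrthonormalBasis ι ℝ V)
    (b' : OrthonormalBasis κ ℝ V) : ∑ i, ‖T (b i)‖ ^ 2 = ∑ k, ‖T (b' k)‖ ^ 2 := by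
  have := sum_bilin_orthonormalBasis ((innerₗ W).compl₁₂ T.toLinearMap T.toLinearMap) b b'
  simpa using this

theorem sum_sum_norm_sq_orthonormalBasis (σ : V →L[ℝ] V →L[ℝ] W) (b : OrthonormalBasis ι ℝ V)
    (b' : OrthonormalBasis κ ℝ V) :
    ∑ i, ∑ j, ‖σ (b i) (b j)‖ ^ 2 = ∑ k, ∑ l, ‖σ (b' k) (b' l)‖ ^ 2 := by
  simp only [sum_norm_sq_orthonormalBasis _ b b']
  rw [Finset.sum_comm]
  simp only [← ContinuousLinearMap.flip_apply σ, sum_norm_sq_orthonormalBasis _ b b']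
  rw [Finset.sum_comm]

theorem sum_diag_orthonormalBasis (σ : V →L[ℝ] V →L[ℝ] W) (b : OrthonormalBasis ι ℝ V)
    (b' : OrthonormalBasis κ ℝ V) : ∑ i, σ (b i) (b i) = ∑ k, σ (b' k) (b' k) :=
  sum_bilin_orthonormalBasis
    ((ContinuousLinearMap.coeLM ℝ (M := V) (N₃ := W)).comp σ.toLinearMap) b b'

theorem sum_sum_norm_sq_some (σ : V →L[ℝ] V →L[ℝ] W) (hσ : ∀ x y, σ x y = σ y x)
    (b : OrthonormalBasis (Option κ) ℝ V) (e : OrthonormalBasis ι ℝ V) :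
    ∑ i, ∑ j, ‖σ (b (some i)) (b (some j))‖ ^ 2 = ∑ i, ∑ j, ‖σ (e i) (e j)‖ ^ 2 -
      2 * ∑ i, ‖σ (b none) (e i)‖ ^ 2 + ‖σ (b none) (b none)‖ ^ 2 := by
  rw [sum_sum_norm_sq_orthonormalBasis σ e b, sum_norm_sq_orthonormalBasis (σ (b none)) e b]
  simp only [Fintype.sum_option, Finset.sum_add_distrib, hσ _ (b none)]
  ring

end BasisIndependence

section QuadraticForm

variable {W : Type*} [NormedAddCommGroup W] [InnerProductSpace ℝ W] {κ : Type*} [Fintype κ]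

/-- The quadratic form in the second fundamental form `h` whose sign decides the Casorati
inequality. The index `none` is the direction normal to the hyperplane. -/
def casoratiForm (N r : ℝ) (h : Option κ → Option κ → W) : ℝ :=
  (N + r) / N * ∑ i, ∑ j, ‖h i j‖ ^ 2 +
    1 / (N * r) * (N - 1) * (N + r) * (N ^ 2 - N - r) *
      (1 / (N - 1) * ∑ i, ∑ j, ‖h (some i) (some j)‖ ^ 2) - ‖∑ i, h i i‖ ^ 2

theorem sum_norm_sub_mean_sq (v : κ → W) (hκ : 0 < Fintype.card κ) :
    ∑ i, ‖v i - (1 / (Fintype.card κ : ℝ)) • ∑ j, v j‖ ^ 2 =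
      ∑ i, ‖v i‖ ^ 2 - 1 / (Fintype.card κ : ℝ) * ‖∑ j, v j‖ ^ 2 := by
  have hk : (Fintype.card κ : ℝ) ≠ 0 := by positivity
  simp only [norm_sub_sq_real, Finset.sum_add_distrib, Finset.sum_sub_distrib, ← Finset.mul_sum,
    ← sum_inner, inner_smul_right, real_inner_self_eq_norm_sq, norm_smul, Finset.sum_const,
    Finset.card_univ, nsmul_eq_mul, mul_pow, Real.norm_eq_abs, sq_abs]
  field_simp
  ring

theorem casoratiForm_eq [DecidableEq κ] {N r : ℝ} (hκ : 0 < Fintype.card κ)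
    (hN : N = Fintype.card κ + 1) (hr : 0 < r) {h : Option κ → Option κ → W}
    (hh : ∀ i j, h i j = h j i) :
    casoratiForm N r h =
      (N + r) * (N - 1) / r * ((∑ i, ∑ j, if i = j then 0 else ‖h (some i) (some j)‖ ^ 2) +
        ∑ i, ‖h (some i) (some i) -
          (1 / (Fintype.card κ : ℝ)) • ∑ j, h (some j) (some j)‖ ^ 2) +
      2 * (N + r) / N * ∑ i, ‖h (some i) none‖ ^ 2 +
      N / r * ‖∑ j, h (some j) (some j) - (r / N) • h none none‖ ^ 2 := by
  have hk : (0 : ℝ) < Fintype.card κ := by exact_mod_cast hκ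
  have hk' : (Fintype.card κ : ℝ) = N - 1 := by rw [hN]; ring
  have hN0 : N ≠ 0 := by rw [hN]; positivity
  have hN1 : N - 1 ≠ 0 := by rw [← hk']; exact hk.ne'
  have hoff : (∑ i, ∑ j, if i = j then 0 else ‖h (some i) (some j)‖ ^ 2) =
      ∑ i, ∑ j, ‖h (some i) (some j)‖ ^ 2 - ∑ i, ‖h (some i) (some i)‖ ^ 2 := by
    rw [← Finset.sum_sub_distrib]
    refine Finset.sum_congr rfl fun i _ => ?_
    rw [eq_sub_iff_add_eq]
    have : ‖h (some i) (some i)‖ ^ 2 = ∑ j, if i = j then ‖h (some i) (some j)‖ ^ 2 else 0 := by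
      simp
    rw [this, ← Finset.sum_add_distrib]
    refine Finset.sum_congr rfl fun j _ => ?_
    split_ifs <;> simp
  rw [hoff, sum_norm_sub_mean_sq (fun i => h (some i) (some i)) hκ, casoratiForm]
  simp only [Fintype.sum_option, Finset.sum_add_distrib, hh none (some _)]
  rw [norm_add_sq_real, norm_sub_sq_real, inner_smul_right, norm_smul, mul_pow,
    Real.norm_eq_abs, sq_abs, hk', real_inner_comm]
  field_simp
  ring

theorem casoratiForm_nonneg {N r : ℝ} (hκ : 0 < Fintype.card κ)
    (hN : N = Fintype.card κ + 1) (hr : 0 < r) {h : Option κ → Option κ → W}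
    (hh : ∀ i j, h i j = h j i) : 0 ≤ casoratiForm N r h := by
  classical
  have hk : (0 : ℝ) < Fintype.card κ := by exact_mod_cast hκ
  have hN1 : 0 ≤ N - 1 := by rw [hN]; linarith
  have hN0 : 0 < N := by linarith
  rw [casoratiForm_eq hκ hN hr hh]
  have : 0 ≤ ∑ i : κ, ∑ j : κ, if i = j then 0 else ‖h (some i) (some j)‖ ^ 2 :=
    Finset.sum_nonneg fun i _ => Finset.sum_nonneg fun j _ => by split_ifs <;> positivity
  positivity

theorem casoratiForm_eq_zero_iff [DecidableEq κ] {N r : ℝ} (hκ : 0 < Fintype.card κ)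
    (hN : N = Fintype.card κ + 1) (hr : 0 < r) {h : Option κ → Option κ → W}
    (hh : ∀ i j, h i j = h j i) :
    casoratiForm N r h = 0 ↔ ∃ ξ : W, ∀ i j, h i j =
      if i = j then (if i = none then (N * (N - 1) / r) • ξ else ξ) else 0 := by
  have hk : (0 : ℝ) < Fintype.card κ := by exact_mod_cast hκ
  have hk' : (Fintype.card κ : ℝ) = N - 1 := by rw [hN]; ring
  have hN1 : 0 < N - 1 := by rw [hN]; linarith
  have hN0 : 0 < N := by linarith
  have h1 : 0 ≤ ∑ i : κ, ∑ j : κ, if i = j then 0 else ‖h (some i) (some j)‖ ^ 2 :=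
    Finset.sum_nonneg fun i _ => Finset.sum_nonneg fun j _ => by split_ifs <;> positivity
  rw [casoratiForm_eq hκ hN hr hh]
  constructor
  · intro h0
    set A := ∑ i : κ, ∑ j : κ, if i = j then 0 else ‖h (some i) (some j)‖ ^ 2 with hA
    set B := ∑ i, ‖h (some i) (some i) -
          (1 / (Fintype.card κ : ℝ)) • ∑ j, h (some j) (some j)‖ ^ 2 with hB
    set C := ∑ i, ‖h (some i) none‖ ^ 2 with hC
    set D := ‖∑ j, h (some j) (some j) - (r / N) • h none none‖ ^ 2 with hD
    have hB0 : 0 ≤ B := by positivity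
    have hC0 : 0 ≤ C := by positivity
    have hD0 : 0 ≤ D := by positivity
    have hc1 : 0 < (N + r) * (N - 1) / r := by positivity
    have hc2 : 0 < 2 * (N + r) / N := by positivity
    have hc3 : 0 < N / r := by positivity
    have hp1 := mul_nonneg hc1.le (add_nonneg h1 hB0)
    have hp2 := mul_nonneg hc2.le hC0
    have hp3 := mul_nonneg hc3.le hD0
    have hAB : A + B = 0 := (mul_eq_zero.1 (by linarith : _ * (A + B) = 0)).resolve_left hc1.ne'
    have hC' : C = 0 := (mul_eq_zero.1 (by linarith : _ * C = 0)).resolve_left hc2.ne'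
    have hD' : D = 0 := (mul_eq_zero.1 (by linarith : _ * D = 0)).resolve_left hc3.ne'
    have hA' : A = 0 := by linarith
    have hB' : B = 0 := by linarith
    have hoff : ∀ i j : κ, i ≠ j → h (some i) (some j) = 0 := by
      intro i j hij
      rw [hA, Finset.sum_eq_zero_iff_of_nonneg (fun i _ => Finset.sum_nonneg fun j _ => by
        split_ifs <;> positivity)] at hA'
      have h2 := hA' i (Finset.mem_univ _)
      rw [Finset.sum_eq_zero_iff_of_nonneg (fun j _ => by split_ifs <;> positivity)] at h2
      have h3 := h2 j (Finset.mem_univ _)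
      rw [if_neg hij] at h3
      simpa using h3
    have hdiag : ∀ i : κ, h (some i) (some i) =
        (1 / (Fintype.card κ : ℝ)) • ∑ j, h (some j) (some j) := by
      intro i
      rw [hB, Finset.sum_eq_zero_iff_of_nonneg (fun i _ => by positivity)] at hB'
      have h3 := hB' i (Finset.mem_univ _)
      rw [← sub_eq_zero]
      simpa using h3
    have hnone : ∀ i : κ, h (some i) none = 0 := by
      intro i
      rw [hC, Finset.sum_eq_zero_iff_of_nonneg (fun i _ => by positivity)] at hC'
      simpa using hC' i (Finset.mem_univ _)
    have hlast : ∑ j, h (some j) (some j) = (r / N) • h none none := by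
      rw [← sub_eq_zero]
      simpa [hD] using hD'
    refine ⟨(1 / (Fintype.card κ : ℝ)) • ∑ j, h (some j) (some j), fun i j => ?_⟩
    rcases i with _ | i <;> rcases j with _ | j
    · rw [if_pos rfl, if_pos rfl, hlast, smul_smul, smul_smul, hk']
      have : N * (N - 1) / r * (1 / (N - 1)) * (r / N) = 1 := by field_simp
      rw [this, one_smul]
    · rw [if_neg (by simp), hh, hnone]
    · rw [if_neg (by simp), hnone]
    · by_cases hij : i = j
      · subst hij
        rw [if_pos rfl, if_neg (by simp), ← hdiag]
      · rw [if_neg (by simpa using hij), hoff i j hij]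
  · rintro ⟨ξ, hξ⟩
    have hd : ∀ i : κ, h (some i) (some i) = ξ := fun i => by rw [hξ]; simp
    have hsum : ∑ j, h (some j) (some j) = (Fintype.card κ : ℝ) • ξ := by
      simp [hd, Nat.cast_smul_eq_nsmul]
    have e1 : (∑ i : κ, ∑ j : κ, if i = j then 0 else ‖h (some i) (some j)‖ ^ 2) = 0 :=
      Finset.sum_eq_zero fun i _ => Finset.sum_eq_zero fun j _ => by
        split_ifs with hij
        · rfl
        · rw [hξ, if_neg (by simpa using hij)]; simp
    have e2 : ∑ i, ‖h (some i) (some i) -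
        (1 / (Fintype.card κ : ℝ)) • ∑ j, h (some j) (some j)‖ ^ 2 = 0 :=
      Finset.sum_eq_zero fun i _ => by
        rw [hsum, hd, smul_smul, one_div_mul_cancel hk.ne', one_smul, sub_self]
        simp
    have e3 : ∑ i, ‖h (some i) none‖ ^ 2 = 0 := Finset.sum_eq_zero fun i _ => by
      rw [hξ, if_neg (by simp)]; simp
    have e4 : ∑ j, h (some j) (some j) - (r / N) • h none none = 0 := by
      rw [hsum, hξ, if_pos rfl, if_pos rfl, smul_smul, hk', ← sub_smul]
      have : N - 1 - r / N * (N * (N - 1) / r) = 0 := by field_simp; ring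
      rw [this, zero_smul]
    rw [e1, e2, e3, e4]
    simp

end QuadraticForm

section Extrema

theorem sInf_mul_eq_iff {A : Set ℝ} (hA : IsCompact A) (hne : A.Nonempty) {a q : ℝ} (ha : 0 < a)
    (h : ∀ x ∈ A, q ≤ a * x) : q ≤ a * sInf A ∧ (q = a * sInf A ↔ ∃ x ∈ A, q = a * x) := by
  have hmem := hA.sInf_mem hne
  refine ⟨h _ hmem, fun h' => ⟨_, hmem, h'⟩, ?_⟩
  rintro ⟨x, hx, h'⟩
  exact le_antisymm (h _ hmem)
    (h' ▸ mul_le_mul_of_nonneg_left (csInf_le hA.bddBelow hx) ha.le)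

theorem sSup_mul_eq_iff {A : Set ℝ} (hA : IsCompact A) (hne : A.Nonempty) {a q : ℝ} (ha : a < 0)
    (h : ∀ x ∈ A, q ≤ a * x) : q ≤ a * sSup A ∧ (q = a * sSup A ↔ ∃ x ∈ A, q = a * x) := by
  have hmem := hA.sSup_mem hne
  refine ⟨h _ hmem, fun h' => ⟨_, hmem, h'⟩, ?_⟩
  rintro ⟨x, hx, h'⟩
  exact le_antisymm (h _ hmem)
    (h' ▸ mul_le_mul_of_nonpos_left (le_csSup hA.bddAbove hx) ha.le)

end Extrema

section Hyperplanes

variable {V : Type*} [NormedAddCommGroup V] [InnerProductSpace ℝ V] [FiniteDimensional ℝ V]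

theorem exists_orthonormalBasis_option {κ : Type*} [Fintype κ] {S : Submodule ℝ V}
    (b : OrthonormalBasis κ ℝ S) (hS : Module.finrank ℝ S + 1 = Module.finrank ℝ V) {u : V}
    (hu : ‖u‖ = 1) (huS : u ∈ Sᗮ) :
    ∃ e : OrthonormalBasis (Option κ) ℝ V, e none = u ∧ ∀ i, e (some i) = b i := by
  classical
  have hv : Orthonormal ℝ (fun i : Option κ => i.elim u fun i => (b i : V)) := by
    rw [orthonormal_iff_ite]
    have hb := orthonormal_iff_ite.1 b.orthonormal
    rintro (_ | i) (_ | j)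
    · simp [hu]
    · simpa using Submodule.inner_left_of_mem_orthogonal (b j).2 huS
    · simpa using Submodule.inner_right_of_mem_orthogonal (b i).2 huS
    · simpa using hb i j
  obtain ⟨e, he⟩ := (hv.comp (fun i : (Set.univ : Set (Option κ)) => (i : Option κ))
    Subtype.val_injective).exists_orthonormalBasis_extension_of_card_eq
      (v := fun i : Option κ => i.elim u fun i => (b i : V)) (s := Set.univ) (by
        rw [Fintype.card_option, ← hS, Module.finrank_eq_card_basis b.toBasis])
  exact ⟨e, he none trivial, fun i => he (some i) trivial⟩

theorem exists_unit_mem_orthogonal {S : Submodule ℝ V}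
    (hS : Module.finrank ℝ S + 1 = Module.finrank ℝ V) : ∃ u ∈ Sᗮ, ‖u‖ = 1 := by
  have h := S.finrank_add_finrank_orthogonal
  have h1 : 0 < Module.finrank ℝ Sᗮ := by omega
  obtain ⟨x, hx⟩ := (Module.finrank_pos_iff_exists_ne_zero (R := ℝ)).1 h1
  have hx' : ‖(x : V)‖ ≠ 0 := by simpa using hx
  exact ⟨‖(x : V)‖⁻¹ • (x : V), Submodule.smul_mem _ _ x.2, by
    rw [norm_smul, norm_inv, norm_norm, inv_mul_cancel₀ hx']⟩

theorem finrank_orthogonal_singleton_add_one {u : V} (hu : ‖u‖ = 1) :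
    Module.finrank ℝ (Submodule.span ℝ {u})ᗮ + 1 = Module.finrank ℝ V := by
  have h := (Submodule.span ℝ {u}).finrank_add_finrank_orthogonal
  rw [finrank_span_singleton (by rintro rfl; simp at hu)] at h
  omega

end Hyperplanes

/-- The last element of `Fin n` corresponds to `none`. -/
def optionEquivFin {k n : ℕ} (h : k + 1 = n) : Option (Fin k) ≃ Fin n :=
  finSuccEquivLast.symm.trans (finCongr h)

theorem optionEquivFin_symm_eq_none_iff {k n : ℕ} (h : k + 1 = n) (i : Fin n) :
    (optionEquivFin h).symm i = none ↔ (i : ℕ) + 1 = n := by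
  subst h
  rw [Equiv.symm_apply_eq]
  simp [optionEquivFin, Fin.ext_iff]

section Submanifolds

variable {n m : ℕ}
  {M : Type*} [TopologicalSpace M] [ChartedSpace (EuclideanSpace ℝ (Fin n)) M]
  [IsManifold (𝓡 n) ∞ M]
  [Bundle.RiemannianBundle (fun x : M => TangentSpace (𝓡 n) x)]
  {M' : Type*} [TopologicalSpace M'] [ChartedSpace (EuclideanSpace ℝ (Fin m)) M']
  [IsManifold (𝓡 m) ∞ M']
  [Bundle.RiemannianBundle (fun x : M' => TangentSpace (𝓡 m) x)]
  [IsContMDiffRiemannianBundle (𝓡 n) ∞ (EuclideanSpace ℝ (Fin n))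
    (fun x : M => TangentSpace (𝓡 n) x)]
  [IsContMDiffRiemannianBundle (𝓡 m) ∞ (EuclideanSpace ℝ (Fin m))
    (fun x : M' => TangentSpace (𝓡 m) x)]

omit [IsManifold (𝓡 n) ∞ M] [Bundle.RiemannianBundle (fun x : M => TangentSpace (𝓡 n) x)]
  [IsContMDiffRiemannianBundle (𝓡 n) ∞ (EuclideanSpace ℝ (Fin n))
    (fun x : M => TangentSpace (𝓡 n) x)] in
theorem finrank_tangentSpace (p : M) : Module.finrank ℝ (TangentSpace (𝓡 n) p) = n :=
  finrank_euclideanSpace_fin (𝕜 := ℝ) (n := n)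

theorem two_mul_scalarCurvature {c : ℝ} (hM' : IsRealSpaceForm m M' c) {f : M → M'}
    (hf : IsIsometricImmersion n m f) (p : M) {ι : Type*} [Fintype ι]
    (b : OrthonormalBasis ι ℝ (TangentSpace (𝓡 n) p)) :
    2 * scalarCurvature n p = n * (n - 1) * c +
      ‖∑ i, secondFundamentalForm n m f p (b i) (b i)‖ ^ 2 -
      ∑ i, ∑ j, ‖secondFundamentalForm n m f p (b i) (b j)‖ ^ 2 := by
  set σ := secondFundamentalForm n m f p
  set e := stdOrthonormalBasis ℝ (TangentSpace (𝓡 n) p) with he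
  rw [sum_diag_orthonormalBasis σ b e, sum_sum_norm_sq_orthonormalBasis σ b e]
  set F : Fin (Module.finrank ℝ (TangentSpace (𝓡 n) p)) →
    Fin (Module.finrank ℝ (TangentSpace (𝓡 n) p)) → ℝ := fun i j =>
      c + ⟪σ (e i) (e i), σ (e j) (e j)⟫_ℝ - ‖σ (e i) (e j)‖ ^ 2 with hF
  have hFs : ∀ i j, F i j = F j i := fun i j => by
    simp only [hF]
    rw [real_inner_comm, secondFundamentalForm_symm hf p (e i) (e j)]
  have hFd : ∀ i, F i i = c := fun i => by
    simp only [hF, real_inner_self_eq_norm_sq]; ring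
  have hK : scalarCurvature n p = ∑ i, ∑ j ∈ Finset.Ioi i, F i j := by
    refine Finset.sum_congr rfl fun i _ => Finset.sum_congr rfl fun j hj => ?_
    exact sectionalCurvature_eq_add hM' hf p (e.norm_eq_one i) (e.norm_eq_one j)
      (e.inner_eq_zero (Finset.mem_Ioi.1 hj).ne)
  have h2 : 2 * scalarCurvature n p = ∑ i, ∑ j, F i j - ∑ i, F i i := by
    have h3 := Finset.sum_sum_Ioi_add_eq_sum_sum_off_diag F
    have h4 : ∀ i, ∑ j ∈ Finset.Ioi i, (F j i + F i j) = 2 * ∑ j ∈ Finset.Ioi i, F i j := by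
      intro i
      rw [Finset.mul_sum]
      exact Finset.sum_congr rfl fun j _ => by rw [hFs j i]; ring
    have h5 : ∀ i, ∑ j ∈ ({i} : Finset _)ᶜ, F j i = ∑ j, F i j - F i i := by
      intro i
      rw [← Finset.sum_add_sum_compl {i} (F i), Finset.sum_singleton, add_sub_cancel_left]
      exact Finset.sum_congr rfl fun j _ => hFs j i
    simp only [h4, h5] at h3
    rw [hK, Finset.mul_sum, h3, Finset.sum_sub_distrib]
  rw [h2]
  simp only [hFd]
  simp only [hF, Finset.sum_sub_distrib, Finset.sum_add_distrib, ← inner_sum, ← sum_inner,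
    real_inner_self_eq_norm_sq, Finset.sum_const, Finset.card_univ, Fintype.card_fin,
    nsmul_eq_mul, finrank_tangentSpace]
  ring

omit [IsContMDiffRiemannianBundle (𝓡 n) ∞ (EuclideanSpace ℝ (Fin n))
    (fun x : M => TangentSpace (𝓡 n) x)]
  [IsContMDiffRiemannianBundle (𝓡 m) ∞ (EuclideanSpace ℝ (Fin m))
    (fun x : M' => TangentSpace (𝓡 m) x)] [IsManifold (𝓡 n) ∞ M] [IsManifold (𝓡 m) ∞ M'] in
theorem casorati_eq (f : M → M') (p : M) {ι : Type*} [Fintype ι]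
    (b : OrthonormalBasis ι ℝ (TangentSpace (𝓡 n) p)) :
    casorati n m f p = 1 / (n : ℝ) *
      ∑ i, ∑ j, ‖secondFundamentalForm n m f p (b i) (b j)‖ ^ 2 := by
  rw [casorati, sum_sum_norm_sq_orthonormalBasis _ (stdOrthonormalBasis ℝ _) b]

theorem casoratiOfSubspace_eq {f : M → M'} (hf : IsIsometricImmersion n m f) (p : M)
    {S : Submodule ℝ (TangentSpace (𝓡 n) p)} (hS : Module.finrank ℝ S + 1 = n)
    {u : TangentSpace (𝓡 n) p} (hu : ‖u‖ = 1) (huS : u ∈ Sᗮ) {ι : Type*} [Fintype ι]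
    (e : OrthonormalBasis ι ℝ (TangentSpace (𝓡 n) p)) :
    casoratiOfSubspace n m f p S = 1 / ((n : ℝ) - 1) *
      (∑ i, ∑ j, ‖secondFundamentalForm n m f p (e i) (e j)‖ ^ 2 -
        2 * ∑ i, ‖secondFundamentalForm n m f p u (e i)‖ ^ 2 +
        ‖secondFundamentalForm n m f p u u‖ ^ 2) := by
  obtain ⟨b, hb, hbS⟩ := exists_orthonormalBasis_option (stdOrthonormalBasis ℝ S)
    (hS.trans (finrank_tangentSpace p).symm) hu huS
  have hn : (Module.finrank ℝ S : ℝ) = n - 1 := by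
    rw [eq_sub_iff_add_eq]; exact_mod_cast hS
  subst hb
  rw [← sum_sum_norm_sq_some _ (secondFundamentalForm_symm hf p) b e, casoratiOfSubspace, hn]
  simp only [hbS]

/-- The Casorati inequality for one hyperplane is the positivity of a quadratic form. -/
theorem casoratiForm_secondFundamentalForm {c : ℝ} (hM' : IsRealSpaceForm m M' c) {f : M → M'}
    (hf : IsIsometricImmersion n m f) (hn : 2 ≤ n) (r : ℝ) (p : M)
    {S : Submodule ℝ (TangentSpace (𝓡 n) p)} (hS : Module.finrank ℝ S + 1 = n)
    {κ : Type*} [Fintype κ] (b : OrthonormalBasis (Option κ) ℝ (TangentSpace (𝓡 n) p))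
    (hb : b none ∈ Sᗮ) :
    casoratiForm n r (fun i j => secondFundamentalForm n m f p (b i) (b j)) =
      coeff n r * casoratiOfSubspace n m f p S -
        (2 * scalarCurvature n p - n * (n - 1) * c - r * casorati n m f p) := by
  have hn0 : (n : ℝ) ≠ 0 := by positivity
  rw [casoratiOfSubspace_eq hf p hS (b.norm_eq_one none) hb b, casorati_eq f p b,
    two_mul_scalarCurvature hM' hf p b,
    ← sum_sum_norm_sq_some _ (secondFundamentalForm_symm hf p) b b, casoratiForm, coeff]
  field_simp
  ring

theorem hyperplaneCasorati_isCompact_nonempty {f : M → M'} (hf : IsIsometricImmersion n m f)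
    (hn : 2 ≤ n) (p : M) :
    IsCompact (hyperplaneCasorati n m f p) ∧ (hyperplaneCasorati n m f p).Nonempty := by
  have hfin := finrank_tangentSpace (n := n) p
  have : Nontrivial (TangentSpace (𝓡 n) p) :=
    Module.nontrivial_of_finrank_pos (R := ℝ) (by omega)
  set e := stdOrthonormalBasis ℝ (TangentSpace (𝓡 n) p)
  set φ : TangentSpace (𝓡 n) p → ℝ := fun u => 1 / ((n : ℝ) - 1) *
      (∑ i, ∑ j, ‖secondFundamentalForm n m f p (e i) (e j)‖ ^ 2 -
        2 * ∑ i, ‖secondFundamentalForm n m f p u (e i)‖ ^ 2 +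
        ‖secondFundamentalForm n m f p u u‖ ^ 2) with hφ
  have hφc : Continuous φ := by
    have h1 : ∀ v, Continuous fun u => ‖secondFundamentalForm n m f p u v‖ ^ 2 := fun v =>
      (((secondFundamentalForm n m f p).continuous.clm_apply continuous_const).norm).pow 2
    have h2 : Continuous fun u => ‖secondFundamentalForm n m f p u u‖ ^ 2 :=
      (((secondFundamentalForm n m f p).continuous.clm_apply continuous_id).norm).pow 2
    exact continuous_const.mul ((continuous_const.sub (continuous_const.mul
      (continuous_finsetSum _ fun i _ => h1 (e i)))).add h2)
  have himg : hyperplaneCasorati n m f p = φ '' Metric.sphere 0 1 := by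
    ext t
    constructor
    · rintro ⟨S, hS, rfl⟩
      obtain ⟨u, huS, hu⟩ := exists_unit_mem_orthogonal (hS.trans hfin.symm)
      exact ⟨u, by simpa using hu, (casoratiOfSubspace_eq hf p hS hu huS e).symm⟩
    · rintro ⟨u, hu, rfl⟩
      have hu' : ‖u‖ = 1 := by simpa using hu
      have hS := (finrank_orthogonal_singleton_add_one hu').trans hfin
      exact ⟨(Submodule.span ℝ {u})ᗮ, hS, casoratiOfSubspace_eq hf p hS hu'
        (Submodule.le_orthogonal_orthogonal _ (Submodule.mem_span_singleton_self u)) e⟩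
  rw [himg]
  exact ⟨(isCompact_sphere 0 1).image hφc, (NormedSpace.sphere_nonempty.2 zero_le_one).image φ⟩

variable (n m) in
/-- The second fundamental form at `p` has the ideal shape: in some orthonormal basis it is
diagonal with entries `ξ, …, ξ, n (n - 1) / r • ξ`. -/
def IsCasoratiIdealAt (f : M → M') (r : ℝ) (p : M) : Prop :=
  ∃ (e : OrthonormalBasis (Fin n) ℝ (TangentSpace (𝓡 n) p)) (ξ : TangentSpace (𝓡 m) (f p)),
    ∀ i j, secondFundamentalForm n m f p (e i) (e j) =
      if i = j then (if (i : ℕ) + 1 = n then ((n : ℝ) * (n - 1) / r) • ξ else ξ) else 0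

theorem exists_hyperplane_eq_iff {c : ℝ} (hM' : IsRealSpaceForm m M' c) {f : M → M'}
    (hf : IsIsometricImmersion n m f) (hn : 2 ≤ n) {r : ℝ} (hr : 0 < r) (p : M) :
    (∃ x ∈ hyperplaneCasorati n m f p,
      2 * scalarCurvature n p - n * (n - 1) * c - r * casorati n m f p = coeff n r * x) ↔
    IsCasoratiIdealAt n m f r p := by
  have hfin := finrank_tangentSpace (n := n) p
  have hsymm := secondFundamentalForm_symm hf p
  constructor
  · rintro ⟨_, ⟨S, hS, rfl⟩, hx⟩
    obtain ⟨u, huS, hu⟩ := exists_unit_mem_orthogonal (hS.trans hfin.symm)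
    obtain ⟨b, hb, -⟩ := exists_orthonormalBasis_option (stdOrthonormalBasis ℝ S)
      (hS.trans hfin.symm) hu huS
    have h0 := casoratiForm_secondFundamentalForm hM' hf hn r p hS b (hb ▸ huS)
    rw [hx, sub_self, casoratiForm_eq_zero_iff (by rw [Fintype.card_fin]; omega)
      (by rw [Fintype.card_fin]; exact_mod_cast hS.symm) hr fun i j => hsymm _ _] at h0
    obtain ⟨ξ, hξ⟩ := h0
    refine ⟨b.reindex (optionEquivFin hS), ξ, fun i j => ?_⟩
    simp only [OrthonormalBasis.reindex_apply, hξ, optionEquivFin_symm_eq_none_iff,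
      EmbeddingLike.apply_eq_iff_eq]
  · rintro ⟨e, ξ, hξ⟩
    obtain ⟨k, hk⟩ : ∃ k, k + 1 = n := ⟨n - 1, by omega⟩
    set b := e.reindex (optionEquivFin hk).symm with hb
    have hS := (finrank_orthogonal_singleton_add_one (b.norm_eq_one none)).trans hfin
    refine ⟨_, ⟨_, hS, rfl⟩, ?_⟩
    have h0 := casoratiForm_secondFundamentalForm hM' hf hn r p hS b
      (Submodule.le_orthogonal_orthogonal _ (Submodule.mem_span_singleton_self _))
    rw [(casoratiForm_eq_zero_iff (by rw [Fintype.card_fin]; omega)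
      (by rw [Fintype.card_fin]; exact_mod_cast hk.symm) hr fun i j => hsymm _ _).2] at h0
    · linarith
    · refine ⟨ξ, fun i j => ?_⟩
      simp only [hb, OrthonormalBasis.reindex_apply, hξ, Equiv.symm_symm,
        EmbeddingLike.apply_eq_iff_eq, ← optionEquivFin_symm_eq_none_iff hk,
        Equiv.symm_apply_apply]

theorem le_coeff_mul_of_mem {c : ℝ} (hM' : IsRealSpaceForm m M' c) {f : M → M'}
    (hf : IsIsometricImmersion n m f) (hn : 2 ≤ n) {r : ℝ} (hr : 0 < r) (p : M) :
    ∀ x ∈ hyperplaneCasorati n m f p,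
      2 * scalarCurvature n p - n * (n - 1) * c - r * casorati n m f p ≤ coeff n r * x := by
  rintro _ ⟨S, hS, rfl⟩
  have hfin := finrank_tangentSpace (n := n) p
  obtain ⟨u, huS, hu⟩ := exists_unit_mem_orthogonal (hS.trans hfin.symm)
  obtain ⟨b, hb, -⟩ := exists_orthonormalBasis_option (stdOrthonormalBasis ℝ S)
    (hS.trans hfin.symm) hu huS
  have h0 := casoratiForm_secondFundamentalForm hM' hf hn r p hS b (hb ▸ huS)
  have h1 := casoratiForm_nonneg (N := n) (by rw [Fintype.card_fin]; omega)
    (by rw [Fintype.card_fin]; exact_mod_cast hS.symm) hr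
    fun i j => secondFundamentalForm_symm hf p (b i) (b j)
  linarith

end Submanifolds

theorem exists_orthonormalBasis_inner_eq {W : Type*} [NormedAddCommGroup W]
    [InnerProductSpace ℝ W] [FiniteDimensional ℝ W] {d : ℕ} (hd : Module.finrank ℝ W = d) (ξ : W) :
    ∃ (N : OrthonormalBasis (Fin d) ℝ W) (a : ℝ),
      ∀ α : Fin d, ⟪N α, ξ⟫_ℝ = if (α : ℕ) = 0 then a else 0 := by
  by_cases hξ : ξ = 0
  · exact ⟨(stdOrthonormalBasis ℝ W).reindex (finCongr hd), 0, by simp [hξ]⟩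
  have hξ' : ‖ξ‖ ≠ 0 := by simpa using hξ
  have hpos : 0 < d := hd ▸ (Module.finrank_pos_iff_exists_ne_zero (R := ℝ)).2 ⟨ξ, hξ⟩
  have hv : Orthonormal ℝ (({⟨0, hpos⟩} : Set (Fin d)).domRestrict fun _ => ‖ξ‖⁻¹ • ξ) := by
    refine ⟨fun i => ?_, fun i j hij => absurd (Subsingleton.elim i j) hij⟩
    change ‖‖ξ‖⁻¹ • ξ‖ = 1
    rw [norm_smul, norm_inv, norm_norm, inv_mul_cancel₀ hξ']
  obtain ⟨N, hN⟩ := hv.exists_orthonormalBasis_extension_of_card_eq (by simpa using hd)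
  have h0 : N ⟨0, hpos⟩ = ‖ξ‖⁻¹ • ξ := hN _ rfl
  have hξN : ξ = ‖ξ‖ • N ⟨0, hpos⟩ := by rw [h0, smul_smul, mul_inv_cancel₀ hξ', one_smul]
  refine ⟨N, ‖ξ‖, fun α => ?_⟩
  rw [hξN, inner_smul_right, orthonormal_iff_ite.1 N.orthonormal, ← hξN]
  simp [Fin.ext_iff]

section Submanifolds

variable {n m : ℕ}
  {M : Type*} [TopologicalSpace M] [ChartedSpace (EuclideanSpace ℝ (Fin n)) M]
  [IsManifold (𝓡 n) ∞ M]
  [Bundle.RiemannianBundle (fun x : M => TangentSpace (𝓡 n) x)]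
  {M' : Type*} [TopologicalSpace M'] [ChartedSpace (EuclideanSpace ℝ (Fin m)) M']
  [IsManifold (𝓡 m) ∞ M']
  [Bundle.RiemannianBundle (fun x : M' => TangentSpace (𝓡 m) x)]

omit [IsManifold (𝓡 n) ∞ M] [IsManifold (𝓡 m) ∞ M'] in
theorem finrank_normalSpace {f : M → M'} (hf : IsIsometricImmersion n m f) (p : M) :
    Module.finrank ℝ (normalSpace n m f p) = m - n := by
  have hinj : Function.Injective (mfderiv (𝓡 n) (𝓡 m) f p).toLinearMap := by
    rw [← LinearMap.ker_eq_bot, LinearMap.ker_eq_bot']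
    intro X hX
    have h := hf.2 p X X
    rw [show mfderiv (𝓡 n) (𝓡 m) f p X = 0 from hX, inner_zero_left] at h
    exact inner_self_eq_zero.1 h.symm
  have h1 := LinearMap.finrank_range_of_inj hinj
  have h2 := (mfderiv (𝓡 n) (𝓡 m) f p).range.finrank_add_finrank_orthogonal
  have h3 := finrank_tangentSpace (n := n) p
  have h4 := finrank_tangentSpace (n := m) (f p)
  rw [normalSpace]
  omega

omit [IsManifold (𝓡 n) ∞ M] [IsManifold (𝓡 m) ∞ M'] in
theorem toMatrix_shapeOperator (f : M → M') (p : M) {ι : Type*} [Fintype ι] [DecidableEq ι]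
    (e : OrthonormalBasis ι ℝ (TangentSpace (𝓡 n) p)) (N : TangentSpace (𝓡 m) (f p)) (i j : ι) :
    LinearMap.toMatrix e.toBasis e.toBasis (shapeOperator n m f p N).toLinearMap i j =
      ⟪N, secondFundamentalForm n m f p (e j) (e i)⟫_ℝ := by
  rw [LinearMap.toMatrix_apply, OrthonormalBasis.coe_toBasis_repr_apply,
    OrthonormalBasis.coe_toBasis, OrthonormalBasis.repr_apply_apply, real_inner_comm]
  exact inner_shapeOperator n m f p N (e j) (e i)

omit [IsManifold (𝓡 n) ∞ M] [IsManifold (𝓡 m) ∞ M'] in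
/-- The ideal second fundamental form, without reference to a basis. -/
theorem IsCasoratiIdealAt.exists_apply_eq {f : M → M'} {r : ℝ} {p : M} (hn : 2 ≤ n)
    (h : IsCasoratiIdealAt n m f r p) :
    ∃ (u : TangentSpace (𝓡 n) p) (ξ : TangentSpace (𝓡 m) (f p)) (s : ℝ), ‖u‖ = 1 ∧
      ∀ X Y, secondFundamentalForm n m f p X Y = ⟪X + (s * ⟪u, X⟫_ℝ) • u, Y⟫_ℝ • ξ := by
  obtain ⟨e, ξ, hξ⟩ := h
  set σ := secondFundamentalForm n m f p
  set ρ := (n : ℝ) * (n - 1) / r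
  set l : Fin n := ⟨n - 1, by omega⟩ with hl
  have hlast : ∀ i : Fin n, (i : ℕ) + 1 = n ↔ i = l := fun i => by
    rw [Fin.ext_iff, hl]; dsimp only; omega
  refine ⟨e l, ξ, ρ - 1, e.norm_eq_one l, fun X Y => ?_⟩
  have h1 : ∀ i, σ (e i) Y = (⟪e i, Y⟫_ℝ * (1 + (ρ - 1) * if i = l then 1 else 0)) • ξ := by
    intro i
    conv_lhs => rw [← e.sum_repr' Y]
    rw [map_sum, Finset.sum_eq_single i]
    · rw [map_smul, hξ, if_pos rfl, mul_smul]
      simp only [hlast]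
      split_ifs
      · congr 2; ring
      · congr 1; simp
    · intro j _ hj
      rw [map_smul, hξ, if_neg hj.symm, smul_zero]
    · simp
  conv_lhs => rw [← e.sum_repr' X]
  simp only [map_sum, map_smul, sum_apply, smul_apply, h1, smul_smul]
  rw [← Finset.sum_smul, inner_add_left, inner_smul_left]
  congr 1
  rw [← e.sum_inner_mul_inner X Y]
  simp only [mul_add, mul_one, Finset.sum_add_distrib, mul_ite, mul_zero, Finset.sum_ite_eq',
    Finset.mem_univ, if_true, RCLike.conj_to_real]
  congr 1
  · exact Finset.sum_congr rfl fun i _ => by rw [real_inner_comm]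
  · ring

omit [IsManifold (𝓡 n) ∞ M] [IsManifold (𝓡 m) ∞ M'] in
theorem isInvariantlyQuasiUmbilical_of_ideal {f : M → M'} (hf : IsIsometricImmersion n m f)
    {r : ℝ} (hn : 2 ≤ n) (h : ∀ p, IsCasoratiIdealAt n m f r p) :
    IsInvariantlyQuasiUmbilical n m f := by
  intro p
  obtain ⟨u, ξ, s, hu, hσ⟩ := (h p).exists_apply_eq hn
  set N := (stdOrthonormalBasis ℝ (normalSpace n m f p)).reindex
    (finCongr (finrank_normalSpace hf p))
  have hA : ∀ (N : TangentSpace (𝓡 m) (f p)) X, shapeOperator n m f p N X =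
      ⟪N, ξ⟫_ℝ • (X + (s * ⟪u, X⟫_ℝ) • u) := fun N X => by
    refine ext_inner_right ℝ fun Y => ?_
    rw [inner_shapeOperator, hσ, inner_smul_right, real_inner_smul_left, mul_comm]
  refine ⟨fun α => N α, u, ?_, fun α => (N α).2, hu, fun α =>
    ⟨⟪(N α : TangentSpace (𝓡 m) (f p)), ξ⟫_ℝ,
      ⟪(N α : TangentSpace (𝓡 m) (f p)), ξ⟫_ℝ * (1 + s), ?_, fun X hX => ?_⟩⟩
  · exact N.orthonormal.comp_linearIsometry (normalSpace n m f p).subtypeₗᵢ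
  · rw [hA, real_inner_self_eq_norm_sq, hu, one_pow, mul_one, mul_smul, add_smul, one_smul]
  · rw [hA, hX, mul_zero, zero_smul, add_zero]

variable [IsContMDiffRiemannianBundle (𝓡 n) ∞ (EuclideanSpace ℝ (Fin n))
    (fun x : M => TangentSpace (𝓡 n) x)]
  [IsContMDiffRiemannianBundle (𝓡 m) ∞ (EuclideanSpace ℝ (Fin m))
    (fun x : M' => TangentSpace (𝓡 m) x)]

theorem hasCasoratiIdealShape_iff {f : M → M'} (hf : IsIsometricImmersion n m f) {r : ℝ}
    (hn : 2 ≤ n) :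
    HasCasoratiIdealShape n m f r ↔ ∀ p, IsCasoratiIdealAt n m f r p := by
  refine forall_congr' fun p => ?_
  have hnormal := secondFundamentalForm_mem_normalSpace hf p
  constructor
  · rintro ⟨e, N, a, hN⟩
    set η : normalSpace n m f p :=
      ∑ α : Fin (m - n), (if (α : ℕ) = 0 then a else 0) • N α with hη
    refine ⟨e, η, fun i j => ?_⟩
    have hentry : ∀ α, ⟪(N α : TangentSpace (𝓡 m) (f p)),
        secondFundamentalForm n m f p (e i) (e j)⟫_ℝ =
        if i = j then (if (i : ℕ) + 1 = n then (n : ℝ) * (n - 1) / r else 1) *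
          (if (α : ℕ) = 0 then a else 0) else 0 := fun α => by
      rw [← toMatrix_shapeOperator, hN]
      split_ifs <;> simp_all [eq_comm]
    have hexp := N.sum_repr' ⟨_, hnormal (e i) (e j)⟩
    have hin : ∀ α, ⟪N α, (⟨_, hnormal (e i) (e j)⟩ : normalSpace n m f p)⟫_ℝ =
        ⟪(N α : TangentSpace (𝓡 m) (f p)), secondFundamentalForm n m f p (e i) (e j)⟫_ℝ :=
      fun α => rfl
    simp only [hin, hentry] at hexp
    have hval := congrArg Subtype.val hexp
    refine hval.symm.trans ?_
    by_cases hij : i = j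
    · simp only [if_pos hij, mul_smul, ← Finset.smul_sum, ← hη]
      split_ifs <;> simp
    · simp only [if_neg hij, zero_smul, Finset.sum_const_zero]
      rfl
  · rintro ⟨e, ξ, hξ⟩
    have hξn : ξ ∈ normalSpace n m f p := by
      have h0 := hξ ⟨0, by omega⟩ ⟨0, by omega⟩
      rw [if_pos rfl, if_neg (by dsimp only; omega)] at h0
      rw [← h0]
      exact hnormal _ _
    obtain ⟨N, a, hN⟩ := exists_orthonormalBasis_inner_eq (finrank_normalSpace hf p)
      (⟨ξ, hξn⟩ : normalSpace n m f p)
    refine ⟨e, N, a, fun α => ?_⟩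
    have hα : ⟪(N α : TangentSpace (𝓡 m) (f p)), ξ⟫_ℝ = if (α : ℕ) = 0 then a else 0 := hN α
    ext i j
    rw [toMatrix_shapeOperator, secondFundamentalForm_symm hf, hξ]
    by_cases hij : i = j
    · subst hij
      rw [if_pos rfl]
      split_ifs with h1 h2 h2 <;> simp [inner_smul_right, hα, h1, h2]
    · rw [if_neg hij, inner_zero_right]
      split_ifs <;> simp [hij]

theorem ideal_iff {c : ℝ} (hM' : IsRealSpaceForm m M' c) {f : M → M'}
    (hf : IsIsometricImmersion n m f) {r : ℝ} (hn : 2 ≤ n) :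
    (∀ p, IsCasoratiIdealAt n m f r p) ↔ IsInvariantlyQuasiUmbilical n m f ∧
      HasTrivialNormalConnection n m f ∧ HasCasoratiIdealShape n m f r := by
  refine ⟨fun h => ⟨isInvariantlyQuasiUmbilical_of_ideal hf hn h, ?_,
    (hasCasoratiIdealShape_iff hf hn).2 h⟩, fun h => (hasCasoratiIdealShape_iff hf hn).1 h.2.2⟩
  refine hasTrivialNormalConnection_of_forall hM' hf fun p => ?_
  obtain ⟨u, ξ, s, -, hσ⟩ := (h p).exists_apply_eq hn
  exact ⟨ξ, fun X => X + (s * ⟪u, X⟫_ℝ) • u, hσ⟩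

end Submanifolds

end Casorati

end

theorem mainTheorem7 (n m : ℕ) (hn : 2 ≤ n)
    {M : Type*} [TopologicalSpace M] [ChartedSpace (EuclideanSpace ℝ (Fin n)) M]
    [IsManifold (𝓡 n) ∞ M]
    [Bundle.RiemannianBundle (fun x : M => TangentSpace (𝓡 n) x)]
    [IsContMDiffRiemannianBundle (𝓡 n) ∞ (EuclideanSpace ℝ (Fin n))
      (fun x : M => TangentSpace (𝓡 n) x)]
    {M' : Type*} [TopologicalSpace M'] [ChartedSpace (EuclideanSpace ℝ (Fin m)) M']
    [IsManifold (𝓡 m) ∞ M']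
    [Bundle.RiemannianBundle (fun x : M' => TangentSpace (𝓡 m) x)]
    [IsContMDiffRiemannianBundle (𝓡 m) ∞ (EuclideanSpace ℝ (Fin m))
      (fun x : M' => TangentSpace (𝓡 m) x)]
    (c : ℝ) (hM' : Casorati.IsRealSpaceForm m M' c)
    (f : M → M') (hf : Casorati.IsIsometricImmersion n m f) (r : ℝ) :
    (0 < r → r < (n : ℝ) * (n - 1) →
      (∀ p : M, Casorati.normalizedScalarCurvature n p ≤
        1 / ((n : ℝ) * (n - 1)) * Casorati.deltaCasorati n m f r p + c) ∧
      ((∀ p : M, Casorati.normalizedScalarCurvature n p =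
          1 / ((n : ℝ) * (n - 1)) * Casorati.deltaCasorati n m f r p + c) ↔
        Casorati.IsInvariantlyQuasiUmbilical n m f ∧
        Casorati.HasTrivialNormalConnection n m f ∧
        Casorati.HasCasoratiIdealShape n m f r)) ∧
    ((n : ℝ) * (n - 1) < r →
      (∀ p : M, Casorati.normalizedScalarCurvature n p ≤
        1 / ((n : ℝ) * (n - 1)) * Casorati.deltaHatCasorati n m f r p + c) ∧
      ((∀ p : M, Casorati.normalizedScalarCurvature n p =
          1 / ((n : ℝ) * (n - 1)) * Casorati.deltaHatCasorati n m f r p + c) ↔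
        Casorati.IsInvariantlyQuasiUmbilical n m f ∧
        Casorati.HasTrivialNormalConnection n m f ∧
        Casorati.HasCasoratiIdealShape n m f r)) := by
  have hn2 : (2 : ℝ) ≤ n := by exact_mod_cast hn
  have hn1 : (0 : ℝ) < n - 1 := by linarith
  have hD : (0 : ℝ) < (n : ℝ) * (n - 1) := by positivity
  have hle : ∀ τ C x : ℝ, 2 * τ / ((n : ℝ) * (n - 1)) ≤ 1 / ((n : ℝ) * (n - 1)) * (r * C + x) + c ↔
      2 * τ - n * (n - 1) * c - r * C ≤ x := fun τ C x => by
    rw [← sub_nonneg, ← sub_nonneg (a := x), show 1 / ((n : ℝ) * (n - 1)) * (r * C + x) + c -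
      2 * τ / ((n : ℝ) * (n - 1)) = (x - (2 * τ - n * (n - 1) * c - r * C)) / ((n : ℝ) * (n - 1)) by
        field_simp; ring,
      le_div_iff₀ hD, zero_mul]
  have heq : ∀ τ C x : ℝ, 2 * τ / ((n : ℝ) * (n - 1)) = 1 / ((n : ℝ) * (n - 1)) * (r * C + x) + c ↔
      2 * τ - n * (n - 1) * c - r * C = x := fun τ C x => by
    rw [← sub_eq_zero, ← sub_eq_zero (b := x), show 2 * τ / ((n : ℝ) * (n - 1)) -
      (1 / ((n : ℝ) * (n - 1)) * (r * C + x) + c) =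
        (2 * τ - n * (n - 1) * c - r * C - x) / ((n : ℝ) * (n - 1)) by field_simp; ring,
      div_eq_zero_iff, or_iff_left hD.ne']
  simp only [Casorati.normalizedScalarCurvature, Casorati.deltaCasorati,
    Casorati.deltaHatCasorati, hle, heq, ← Casorati.ideal_iff hM' hf hn]
  refine ⟨fun hr hr' => ?_, fun hr' => ?_⟩
  · have ha : 0 < Casorati.coeff n r := by
      have : 0 < (n : ℝ) ^ 2 - n - r := by linarith
      rw [Casorati.coeff]
      positivity
    have key := fun p => Casorati.sInf_mul_eq_iff
      (Casorati.hyperplaneCasorati_isCompact_nonempty hf hn p).1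
      (Casorati.hyperplaneCasorati_isCompact_nonempty hf hn p).2 ha
      (Casorati.le_coeff_mul_of_mem hM' hf hn hr p)
    exact ⟨fun p => (key p).1, forall_congr' fun p => (key p).2.trans
      (Casorati.exists_hyperplane_eq_iff hM' hf hn hr p)⟩
  · have hr : 0 < r := hD.trans hr'
    have ha : Casorati.coeff n r < 0 := by
      have : (n : ℝ) ^ 2 - n - r < 0 := by linarith
      rw [Casorati.coeff]
      exact mul_neg_of_pos_of_neg (by positivity) this
    have key := fun p => Casorati.sSup_mul_eq_iff
      (Casorati.hyperplaneCasorati_isCompact_nonempty hf hn p).1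
      (Casorati.hyperplaneCasorati_isCompact_nonempty hf hn p).2 ha
      (Casorati.le_coeff_mul_of_mem hM' hf hn hr p)
    exact ⟨fun p => (key p).1, forall_congr' fun p => (key p).2.trans
      (Casorati.exists_hyperplane_eq_iff hM' hf hn hr p)⟩
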